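/- Let $n\ge 1$, let $(M,\omega)$ be an $n$-plectic manifold (that is, $M$ is a smooth manifold and $\omega\in\Omega^{n+1}(M)$ is closed with $T_aM\to\Lambda^nT_a^*M$, $u\mapsto\iota_u\omega_a$, injective for every $a\in M$), and let $H\in\Omega^{n-1}(M)$ be a Hamiltonian form with Hamiltonian vector field $v_H$, i.e. $dH=-\iota_{v_H}\omega$. Let $\mathfrak g$ be a real Lie algebra and $\mathfrak g\to\mathfrak X(M)$, $x\mapsto v_x$, a Lie algebra homomorphism with $\mathcal L_{v_x}\omega=0$ and $\mathcal L_{v_x}H=0$ for all $x\in\mathfrak g$ (a strictly $H$-preserving infinitesimal action). Notation: $\varsigma(k)=-(-1)^{k(k+1)/2}$; $\iota(v_p)=\iota_{v_{x_k}}\cdots\iota_{v_{x_1}}$ for $p=x_1\wedge\dots\wedge x_k$, extended linearly to $p\in\Lambda^k\mathfrak g$; $\partial(x_1\wedge\dots\wedge x_k)=\sum_{i<j}(-1)^{i+j}[x_i,x_j]\wedge x_1\wedge\dots\wedge\hat x_i\wedge\dots\wedge\hat x_j\wedge\dots\wedge x_k$ is the Lie algebra homology differential (with $\partial=0$ on $\Lambda^0\mathfrak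 g$ and $\Lambda^1\mathfrak g$), and $Z_k(\mathfrak g)=\ker\partial|_{\Lambda^k\mathfrak g}$. A co-momentum map for an action $v$ with $\mathcal L_{v_x}\omega=0$ is a family of linear maps $f_k:\Lambda^k\mathfrak g\to\Omega^{n-k}(M)$, $1\le k\le n$, with $d f_1(x)=-\iota_{v_x}\omega$ for all $x\in\mathfrak g$ (in particular each $f_1(x)$ is a Hamiltonian form) and $$-f_{k-1}(\partial p)=d f_k(p)+\varsigma(k)\,\iota(v_p)\omega\qquad\text{for }1\le k\le n+1,\ p\in\Lambda^k\mathfrak g,$$ where $f_0=f_{n+1}=0$. A form $\alpha$ is globally conserved by a vector field $u$ if $\mathcal L_u\alpha$ is exact (for $\alpha\in\Omega^0(M)$: if $\mathcal L_u\alpha=0$). Let $(f)$ be a co-momentum map for $x\mapsto v_x$. Then: 1. On the direct sum Lie algebra $\tilde{\mathfrak g}=\mathfrak g\oplus\mathbb R c$, the map extending $x\mapsto v_x$ by $c\mapsto v_H$ is a Lie algebra homomorphism $\tilde{\mathfrak g}\to\mathfrak X(M)$ whose values preserve $\omega$. 2. There is exactly one co-momentum map $(\tilde f)$ for this $\tilde{\mathfrak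 g}$-action that restricts to $(f)$ on $\Lambda^\bullet\mathfrak g$ and satisfies, for $1\le k\le n$ and $p\in\Lambda^{k-1}\mathfrak g$, writing $p\otimes c:=p\wedge c\in\Lambda^k\tilde{\mathfrak g}$, $$\tilde f_k(p\otimes c)=\varsigma(k)\,\iota(v_p)H .$$ 3. For all $1\le k\le n$ and all $p\in Z_{k-1}(\mathfrak g)$, the form $\tilde f_k(p\otimes c)$ is globally conserved by $v_H$. (It is not assumed that $\mathcal L_{v_H}H=0$.) -/

import Mathlib

open scoped Manifold ContDiff

noncomputable section

namespace Multisymplectic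

/-! ## Multilinear algebra -/

section Algebra

variable {V : Type*} [AddCommGroup V] [Module ℝ V] [TopologicalSpace V]

/-- Interior product of an alternating form with one vector:
`(ι_X a)(w₁, …, w_j) = a(X, w₁, …, w_j)`. -/
def interior {j : ℕ} (X : V) (a : V [⋀^Fin (j + 1)]→L[ℝ] ℝ) : V [⋀^Fin j]→L[ℝ] ℝ where
  toFun w := a (Fin.cons X w)
  map_update_add' w i y z := by
    have := (a.toAlternatingMap.curryLeft X).map_update_add' w i y z
    exact this
  map_update_smul' w i c y := by
    have := (a.toAlternatingMap.curryLeft X).map_update_smul' w i c y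
    exact this
  cont := by
    refine a.cont.comp (continuous_pi fun i => ?_)
    refine Fin.cases ?_ (fun i => ?_) i
    · simpa using continuous_const
    · simpa using continuous_apply i
  map_eq_zero_of_eq' w i i' h hne :=
    (a.toAlternatingMap.curryLeft X).map_eq_zero_of_eq' w i i' h hne

theorem append_update {k j : ℕ} {α : Type*} [DecidableEq (Fin k)] (X : Fin k → α)
    (w : Fin j → α) (i : Fin k) (y : α) :
    Fin.append (Function.update X i y) w
      = Function.update (Fin.append X w) (Fin.castAdd j i) y := by
  funext a
  refine Fin.addCases (fun a => ?_) (fun a => ?_) a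
  · by_cases h : a = i
    · subst h; simp
    · have : Fin.castAdd j a ≠ Fin.castAdd j i := fun e => h (Fin.castAdd_injective _ _ e)
      simp [h]
  · have : Fin.natAdd k a ≠ Fin.castAdd j i := by
      intro e; have := congrArg Fin.val e; simp at this; omega
    simp [this]

theorem append_update_right {k j : ℕ} {α : Type*} [DecidableEq (Fin j)] (X : Fin k → α)
    (w : Fin j → α) (i : Fin j) (y : α) :
    Fin.append X (Function.update w i y)
      = Function.update (Fin.append X w) (Fin.natAdd k i) y := by
  funext a
  refine Fin.addCases (fun a => ?_) (fun a => ?_) a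
  · have : Fin.castAdd j a ≠ Fin.natAdd k i := by
      intro e; have := congrArg Fin.val e; simp at this; omega
    simp [this]
  · by_cases h : a = i
    · subst h; simp
    · have : Fin.natAdd k a ≠ Fin.natAdd k i := fun e => h (Fin.natAdd_injective _ _ e)
      simp [h]

/-- Contraction with `k` vectors: `ι(X₁ ∧ … ∧ X_k) a = ι_{X_k} ⋯ ι_{X_1} a`, that is,
`(w₁, …, w_j) ↦ a(X₁, …, X_k, w₁, …, w_j)`. -/
def contractVectors {k j N : ℕ} (h : k + j = N) (a : V [⋀^Fin N]→L[ℝ] ℝ) (X : Fin k → V) :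
    V [⋀^Fin j]→L[ℝ] ℝ where
  toFun w := a (fun i => Fin.append X w (Fin.cast h.symm i))
  map_update_add' w i y z := by
    subst h
    have := a.map_update_add' (Fin.append X w) (Fin.natAdd k i) y z
    simp only [← append_update_right] at this
    exact this
  map_update_smul' w i c y := by
    subst h
    have := a.map_update_smul' (Fin.append X w) (Fin.natAdd k i) c y
    simp only [← append_update_right] at this
    exact this
  cont := by
    subst h
    refine a.cont.comp (continuous_pi fun i => ?_)
    refine Fin.addCases (fun i => ?_) (fun i => ?_) i
    · simpa using continuous_const
    · simpa using continuous_apply i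
  map_eq_zero_of_eq' w i i' hw hne := by
    subst h
    refine a.map_eq_zero_of_eq' _ (Fin.natAdd k i) (Fin.natAdd k i') (by simpa using hw) ?_
    exact fun e => hne (Fin.natAdd_injective _ _ e)

/-- `contractVectors` as an alternating function of the `k` vectors. -/
def contractAlt {k j N : ℕ} (h : k + j = N) (a : V [⋀^Fin N]→L[ℝ] ℝ) :
    V [⋀^Fin k]→ₗ[ℝ] (V [⋀^Fin j]→L[ℝ] ℝ) where
  toFun X := contractVectors h a X
  map_update_add' X i y z := by
    subst h
    ext w
    have := a.map_update_add' (Fin.append X w) (Fin.castAdd j i) y z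
    simp only [← append_update] at this
    exact this
  map_update_smul' X i c y := by
    subst h
    ext w
    have := a.map_update_smul' (Fin.append X w) (Fin.castAdd j i) c y
    simp only [← append_update] at this
    exact this
  map_eq_zero_of_eq' X i i' hX hne := by
    subst h
    ext w
    refine a.map_eq_zero_of_eq' _ (Fin.castAdd j i) (Fin.castAdd j i') (by simpa using hX) ?_
    exact fun e => hne (Fin.castAdd_injective _ _ e)

/-- Contraction `ι(P) a` of an alternating form with a multivector `P ∈ Λᵏ V`: the linear
extension of `contractVectors`. -/
def contract {k j N : ℕ} (h : k + j = N) (P : ⋀[ℝ]^k V) (a : V [⋀^Fin N]→L[ℝ] ℝ) :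
    V [⋀^Fin j]→L[ℝ] ℝ :=
  exteriorPower.alternatingMapLinearEquiv (contractAlt h a) P

end Algebra

/-- The product `p ∧ c ∈ Λ^{k+1} V` of `p ∈ Λᵏ V` with a vector `c`. -/
def wedgeVector {V : Type*} [AddCommGroup V] [Module ℝ V] {k : ℕ} (p : ⋀[ℝ]^k V) (c : V) :
    ⋀[ℝ]^(k + 1) V :=
  ⟨(p : ExteriorAlgebra ℝ V) * ExteriorAlgebra.ι ℝ c, by
    change _ ∈ LinearMap.range (ExteriorAlgebra.ι ℝ : V →ₗ[ℝ] _) ^ (k + 1)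
    rw [pow_succ]
    exact Submodule.mul_mem_mul p.2 ⟨c, rfl⟩⟩

/-- The sign `ς(k) = -(-1)^{k(k+1)/2}`. -/
def sgn (k : ℕ) : ℝ := -(-1) ^ (k * (k + 1) / 2)

/-! ## Lie algebra homology -/

section LieHomology

variable {𝔤 : Type*} [LieRing 𝔤] [LieAlgebra ℝ 𝔤]

open ExteriorAlgebra in
/-- Auxiliary: the derivation of `Λ 𝔤` extending `ad y`. -/
def adExt (y : 𝔤) : ExteriorAlgebra ℝ 𝔤 →ₗ[ℝ] ExteriorAlgebra ℝ 𝔤 :=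
  CliffordAlgebra.foldr' (0 : QuadraticForm ℝ 𝔤)
    (LinearMap.mk₂ ℝ (fun x (qs : ExteriorAlgebra ℝ 𝔤 × ExteriorAlgebra ℝ 𝔤) =>
        ι ℝ ⁅y, x⁆ * qs.1 + ι ℝ x * qs.2)
      (by intros; simp [add_mul]; abel) (by intros; simp)
      (by intros; simp [mul_add]; abel) (by intros; simp))
    (by
      intro x q s
      change ι ℝ ⁅y, x⁆ * (ι ℝ x * q) + ι ℝ x * (ι ℝ ⁅y, x⁆ * q + ι ℝ x * s) = _
      rw [mul_add, ← mul_assoc, ← mul_assoc, ← mul_assoc, ι_sq_zero, zero_mul, add_zero,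
        ← add_mul, ι_add_mul_swap]
      simp)
    0

open ExteriorAlgebra in
theorem adExt_ι_mul (y x : 𝔤) (q : ExteriorAlgebra ℝ 𝔤) :
    adExt y (ι ℝ x * q) = ι ℝ ⁅y, x⁆ * q + ι ℝ x * adExt y q :=
  CliffordAlgebra.foldr'_ι_mul _ _ _ _ _ _

theorem adExt_algebraMap (y : 𝔤) (r : ℝ) :
    adExt y (algebraMap ℝ (ExteriorAlgebra ℝ 𝔤) r) = 0 := by
  unfold adExt
  exact (CliffordAlgebra.foldr'_algebraMap _ _ _ _ r).trans (smul_zero r)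

theorem adExt_add (y z : 𝔤) (q : ExteriorAlgebra ℝ 𝔤) :
    adExt (y + z) q = adExt y q + adExt z q := by
  induction q using CliffordAlgebra.left_induction with
  | algebraMap r =>
    have h (w : 𝔤) := adExt_algebraMap w r
    exact (h _).trans (by rw [show (0 : ExteriorAlgebra ℝ 𝔤) = 0 + 0 by simp]; congr 1 <;> exact (h _).symm)
  | add a b ha hb => rw [map_add, map_add, map_add, ha, hb]; abel
  | ι_mul x m hx =>
    have h (w : 𝔤) := adExt_ι_mul w m x
    refine (h _).trans ?_
    rw [show adExt y _ = _ from h y, show adExt z _ = _ from h z, hx, add_lie, map_add]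
    noncomm_ring

theorem adExt_smul (c : ℝ) (y : 𝔤) (q : ExteriorAlgebra ℝ 𝔤) :
    adExt (c • y) q = c • adExt y q := by
  induction q using CliffordAlgebra.left_induction with
  | algebraMap r =>
    have h (w : 𝔤) := adExt_algebraMap w r
    exact (h _).trans (by rw [show adExt y _ = _ from h y, smul_zero])
  | add a b ha hb => rw [map_add, map_add, ha, hb, smul_add]
  | ι_mul x m hx =>
    have h (w : 𝔤) := adExt_ι_mul w m x
    refine (h _).trans ?_
    rw [show adExt y _ = _ from h y, hx, smul_lie, map_smul]
    simp

open ExteriorAlgebra in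
/-- Auxiliary: the homology differential on the whole exterior algebra, given by
`∂(x ∧ q) = -x ∧ ∂q - ad_x q`. -/
def boundaryExt : ExteriorAlgebra ℝ 𝔤 →ₗ[ℝ] ExteriorAlgebra ℝ 𝔤 :=
  CliffordAlgebra.foldr' (0 : QuadraticForm ℝ 𝔤)
    (LinearMap.mk₂ ℝ (fun x (qs : ExteriorAlgebra ℝ 𝔤 × ExteriorAlgebra ℝ 𝔤) =>
        -(ι ℝ x * qs.2) - adExt x qs.1)
      (by intros; simp [add_mul, adExt_add]; abel)
      (by intros; simp [adExt_smul, smul_sub])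
      (by intros; simp [mul_add]; abel) (by intros; simp [smul_sub]))
    (by
      intro x q s
      change -(ι ℝ x * (-(ι ℝ x * s) - adExt x q)) - adExt x (ι ℝ x * q) = _
      rw [adExt_ι_mul, mul_sub, mul_neg, ← mul_assoc, ι_sq_zero]
      simp)
    0

open ExteriorAlgebra in
theorem boundaryExt_ι_mul (x : 𝔤) (q : ExteriorAlgebra ℝ 𝔤) :
    boundaryExt (ι ℝ x * q) = -(ι ℝ x * boundaryExt q) - adExt x q :=
  CliffordAlgebra.foldr'_ι_mul _ _ _ _ _ _

theorem boundaryExt_one : boundaryExt (1 : ExteriorAlgebra ℝ 𝔤) = 0 := by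
  rw [← map_one (algebraMap ℝ (ExteriorAlgebra ℝ 𝔤))]
  unfold boundaryExt
  exact (CliffordAlgebra.foldr'_algebraMap _ _ _ _ 1).trans (smul_zero _)

theorem adExt_one (y : 𝔤) : adExt y (1 : ExteriorAlgebra ℝ 𝔤) = 0 := by
  simpa using adExt_algebraMap y 1

theorem adExt_ιMulti (y : 𝔤) {k : ℕ} (x : Fin (k + 1) → 𝔤) :
    adExt y (ExteriorAlgebra.ιMulti ℝ (k + 1) x) =
      ∑ j : Fin (k + 1), (-1 : ℝ) ^ (j : ℕ) •
        (ExteriorAlgebra.ι ℝ ⁅y, x j⁆ * ExteriorAlgebra.ιMulti ℝ k (fun l => x (j.succAbove l))) := by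
  induction k with
  | zero =>
    rw [ExteriorAlgebra.ιMulti_succ_apply, adExt_ι_mul]
    simp [adExt_one]
  | succ k ih =>
    rw [ExteriorAlgebra.ιMulti_succ_apply, adExt_ι_mul, ih]
    refine Eq.trans ?_ (Fin.sum_univ_succ _).symm
    congr 1
    · simp [Matrix.vecTail, Function.comp_def]
    · rw [Finset.mul_sum]
      refine Finset.sum_congr rfl fun j _ => ?_
      rw [ExteriorAlgebra.ιMulti_succ_apply (v := fun l => x (j.succ.succAbove l))]
      simp only [Matrix.vecTail, Function.comp_def, Fin.succ_succAbove_zero,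
        Fin.succ_succAbove_succ, Fin.val_succ, pow_succ, mul_smul_comm, ← mul_assoc]
      rw [eq_neg_of_add_eq_zero_left (ExteriorAlgebra.ι_add_mul_swap (x 0) ⁅y, x j.succ⁆)]
      simp

theorem boundaryExt_ιMulti {k : ℕ} (x : Fin (k + 2) → 𝔤) :
    boundaryExt (ExteriorAlgebra.ιMulti ℝ (k + 2) x) =
      ∑ i : Fin (k + 2), ∑ j : Fin (k + 1), if i ≤ j.castSucc then
        (-1 : ℝ) ^ ((i : ℕ) + j + 1) • ExteriorAlgebra.ιMulti ℝ (k + 1)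
          (Fin.cons ⁅x i, x j.succ⁆ fun l => x (i.succAbove (j.succAbove l)))
        else 0 := by
  have hc (k : ℕ) (y : 𝔤) (z : Fin k → 𝔤) : ExteriorAlgebra.ιMulti ℝ (k + 1) (Fin.cons y z) =
      ExteriorAlgebra.ι ℝ y * ExteriorAlgebra.ιMulti ℝ k z := by
    rw [ExteriorAlgebra.ιMulti_succ_apply]; rfl
  simp only [hc]
  induction k with
  | zero =>
    rw [ExteriorAlgebra.ιMulti_succ_apply, boundaryExt_ι_mul, adExt_ιMulti,
      ExteriorAlgebra.ιMulti_succ_apply, boundaryExt_ι_mul]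
    simp [boundaryExt_one, adExt_one, Matrix.vecTail]
  | succ k ih =>
    rw [ExteriorAlgebra.ιMulti_succ_apply, boundaryExt_ι_mul, adExt_ιMulti, ih,
      sub_eq_add_neg, add_comm]
    refine Eq.trans ?_ (Fin.sum_univ_succ _).symm
    congr 1
    · rw [← Finset.sum_neg_distrib]
      refine Finset.sum_congr rfl fun j _ => ?_
      simp [Matrix.vecTail, Function.comp_def, pow_succ]
    · rw [Finset.mul_sum, ← Finset.sum_neg_distrib]
      refine Finset.sum_congr rfl fun i _ => ?_
      refine Eq.trans ?_ (Fin.sum_univ_succ _).symm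
      rw [if_neg (by simp), zero_add, Finset.mul_sum,
        ← Finset.sum_neg_distrib]
      refine Finset.sum_congr rfl fun j _ => ?_
      rw [← Fin.succ_castSucc]
      simp only [Fin.succ_le_succ_iff]
      split_ifs
      · rw [ExteriorAlgebra.ιMulti_succ_apply
          (v := fun l => x (i.succ.succAbove (j.succ.succAbove l)))]
        simp only [Matrix.vecTail, Function.comp_def, Fin.succ_succAbove_zero,
          Fin.succ_succAbove_succ, Fin.val_succ, mul_smul_comm, ← mul_assoc]
        rw [eq_neg_of_add_eq_zero_left
          (ExteriorAlgebra.ι_add_mul_swap (x 0) ⁅x i.succ, x j.succ.succ⁆)]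
        have e : (-1 : ℝ) ^ ((i : ℕ) + 1 + (j + 1) + 1) = (-1) ^ ((i : ℕ) + j + 1) := by ring
        rw [e]
        simp
      · simp

/-- The Lie algebra homology differential on decomposable elements, with indices from zero:
`∂(x₀ ∧ … ∧ x_{k+1}) = ∑_{i < j'} (-1)^{i+j'} [x_i, x_{j'}] ∧ x₀ ∧ … x̂_i … x̂_{j'} … ∧ x_{k+1}`,
where `j' = j + 1`. -/
def boundaryFun (k : ℕ) (x : Fin (k + 2) → 𝔤) : ⋀[ℝ]^(k + 1) 𝔤 :=
  ∑ i : Fin (k + 2), ∑ j : Fin (k + 1), if i ≤ j.castSucc then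
    (-1 : ℝ) ^ ((i : ℕ) + j + 1) • exteriorPower.ιMulti ℝ (k + 1)
      (Fin.cons ⁅x i, x j.succ⁆ fun l => x (i.succAbove (j.succAbove l)))
    else 0

theorem coe_boundaryFun {k : ℕ} (x : Fin (k + 2) → 𝔤) :
    (boundaryFun k x : ExteriorAlgebra ℝ 𝔤) =
      boundaryExt (ExteriorAlgebra.ιMulti ℝ (k + 2) x) := by
  rw [boundaryExt_ιMulti]
  simp only [boundaryFun, AddSubmonoidClass.coe_finsetSum]
  refine Finset.sum_congr rfl fun i _ => Finset.sum_congr rfl fun j _ => ?_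
  split_ifs <;> simp

/-- `boundaryFun` as an alternating map. -/
def boundaryAlt (k : ℕ) : 𝔤 [⋀^Fin (k + 2)]→ₗ[ℝ] ⋀[ℝ]^(k + 1) 𝔤 where
  toFun := boundaryFun k
  map_update_add' := by intros; apply Subtype.ext; simp [coe_boundaryFun]
  map_update_smul' := by intros; apply Subtype.ext; simp [coe_boundaryFun]
  map_eq_zero_of_eq' := by
    intro x i j h hne
    apply Subtype.ext
    rw [coe_boundaryFun, AlternatingMap.map_eq_zero_of_eq _ x h hne]
    simp

/-- The Lie algebra homology differential `∂ : Λ^{k+1} 𝔤 → Λᵏ 𝔤`. -/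
def boundary : ∀ k : ℕ, ⋀[ℝ]^(k + 1) 𝔤 →ₗ[ℝ] ⋀[ℝ]^k 𝔤
  | 0 => 0
  | k + 1 => exteriorPower.alternatingMapLinearEquiv (boundaryAlt k)

variable (𝔤) in
/-- `Z_k(𝔤)`: the cycles of degree `k` (`∂` vanishes on `Λ⁰ 𝔤`). -/
def cycles : ∀ k : ℕ, Submodule ℝ (⋀[ℝ]^k 𝔤)
  | 0 => ⊤
  | k + 1 => LinearMap.ker (boundary k)

end LieHomology

/-! ## Differential forms on a manifold -/

section Forms

variable {E : Type*} [NormedAddCommGroup E] [NormedSpace ℝ E]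
  {M : Type*} [TopologicalSpace M] [ChartedSpace E M]

variable (E M) in
/-- Fields of alternating `k`-forms on the tangent spaces of `M`, with no regularity. -/
abbrev RawForm (k : ℕ) : Type _ :=
  ∀ x : M, (TangentSpace 𝓘(ℝ, E) x) [⋀^Fin k]→L[ℝ] ℝ

/-- The expression of a form in the chart around `x₀`: its pullback under the inverse chart. -/
def chartRep {k : ℕ} (x₀ : M) (α : RawForm E M k) : E → E [⋀^Fin k]→L[ℝ] ℝ := fun y =>
  (α ((extChartAt 𝓘(ℝ, E) x₀).symm y)).compContinuousLinearMap
    (mfderiv 𝓘(ℝ, E) 𝓘(ℝ, E) (extChartAt 𝓘(ℝ, E) x₀).symm y)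

variable (E M) in
/-- The space of smooth `k`-forms, i.e. those whose expression in every chart is `C^∞`. -/
def Form (k : ℕ) : Submodule ℝ (RawForm E M k) where
  carrier := {α | ∀ x₀ : M, ContDiffOn ℝ ∞ (chartRep x₀ α) (extChartAt 𝓘(ℝ, E) x₀).target}
  add_mem' ha hb x₀ := (ha x₀).add (hb x₀)
  zero_mem' _ := contDiffOn_const (c := (0 : E [⋀^Fin k]→L[ℝ] ℝ))
  smul_mem' c _ ha x₀ := (ha x₀).const_smul c

/-- The exterior derivative: at `x`, it is Mathlib's exterior derivative of the expression of the
form in the chart around `x`, pulled back to `T_x M` by the chart. -/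
def extD {k : ℕ} (α : RawForm E M k) : RawForm E M (k + 1) := fun x =>
  (extDeriv (chartRep x α) (extChartAt 𝓘(ℝ, E) x x)).compContinuousLinearMap
    (mfderiv 𝓘(ℝ, E) 𝓘(ℝ, E) (extChartAt 𝓘(ℝ, E) x) x)

variable [IsManifold 𝓘(ℝ, E) ∞ M]

variable (E M) in
/-- `𝔛(M)`: the smooth vector fields on `M`. -/
abbrev VField : Type _ := ContMDiffSection 𝓘(ℝ, E) E ∞ (TangentSpace 𝓘(ℝ, E) : M → Type _)

variable (E) in
/-- The value of a vector field at a point, as a linear map. -/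
def evalAt (x : M) : VField E M →ₗ[ℝ] TangentSpace 𝓘(ℝ, E) x where
  toFun X := X x
  map_add' _ _ := rfl
  map_smul' _ _ := rfl

/-- The interior product `ι_X α`. -/
def iota {k : ℕ} (X : VField E M) (α : RawForm E M (k + 1)) : RawForm E M k := fun x =>
  interior (X x) (α x)

/-- The Lie derivative `L_X = d ι_X + ι_X d` (on functions `L_X = ι_X d`). -/
def lieD : ∀ {k : ℕ}, VField E M → RawForm E M k → RawForm E M k
  | 0, X, α => iota X (extD α)
  | _ + 1, X, α => extD (iota X α) + iota X (extD α)

/-- A form is exact if it is `d` of a smooth form; there are no nonzero forms of degree `-1`. -/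
def IsExact : ∀ {k : ℕ}, RawForm E M k → Prop
  | 0, α => α = 0
  | k + 1, α => ∃ γ ∈ Form E M k, extD γ = α

/-- `α` is globally conserved by `X`: the Lie derivative `L_X α` is exact. -/
def GloballyConserved {k : ℕ} (X : VField E M) (α : RawForm E M k) : Prop :=
  IsExact (lieD X α)

/-- `Ω` is an `n`-plectic form: a closed, nondegenerate form of degree `n + 1`. -/
structure IsPlectic {n : ℕ} (Ω : Form E M (n + 1)) : Prop where
  closed : extD (Ω : RawForm E M (n + 1)) = 0
  nondegenerate : ∀ x : M, Function.Injective
    fun X : TangentSpace 𝓘(ℝ, E) x => interior X ((Ω : RawForm E M (n + 1)) x)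

/-- `X` is a Hamiltonian vector field of the `(n-1)`-form `α`, where `n = m + 1`:
`dα = -ι_X Ω`. -/
def IsHamiltonianVF {m : ℕ} (Ω : Form E M (m + 2)) (α : Form E M m) (X : VField E M) : Prop :=
  extD (α : RawForm E M m) = -iota X (Ω : RawForm E M (m + 2))

/-- `α` is a Hamiltonian form. -/
def IsHamiltonianForm {m : ℕ} (Ω : Form E M (m + 2)) (α : Form E M m) : Prop :=
  ∃ X : VField E M, IsHamiltonianVF Ω α X

end Forms

/-! ## Infinitesimal actions and homotopy co-momentum maps -/

section Actions

variable {E : Type*} [NormedAddCommGroup E] [NormedSpace ℝ E]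
  {M : Type*} [TopologicalSpace M] [ChartedSpace E M] [IsManifold 𝓘(ℝ, E) ∞ M]
  {𝔤 : Type*} [LieRing 𝔤] [LieAlgebra ℝ 𝔤]

/-- `v : 𝔤 → 𝔛(M)` is a multisymplectic infinitesimal action: a homomorphism of Lie algebras
with `L_{v_x} Ω = 0` for all `x`. -/
structure IsMultisymplecticAction {N : ℕ} (Ω : Form E M N) (v : 𝔤 →ₗ[ℝ] VField E M) : Prop where
  map_lie : ∀ (x y : 𝔤) (a : M),
    v ⁅x, y⁆ a = VectorField.mlieBracket 𝓘(ℝ, E) (v x) (v y) a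
  preserves : ∀ x : 𝔤, lieD (v x) (Ω : RawForm E M N) = 0

/-- The action is strictly `H`-preserving: `L_{v_x} H = 0` for all `x`. -/
def StrictlyPreserves {k : ℕ} (v : 𝔤 →ₗ[ℝ] VField E M) (H : Form E M k) : Prop :=
  ∀ x : 𝔤, lieD (v x) (H : RawForm E M k) = 0

/-- `ι(v_p) α`, where `v_p = v_{x₁} ∧ … ∧ v_{x_k}` for `p = x₁ ∧ … ∧ x_k`, extended linearly
to all `p ∈ Λᵏ 𝔤`. -/
def iotaP {k j N : ℕ} (h : k + j = N) (v : 𝔤 →ₗ[ℝ] VField E M) (p : ⋀[ℝ]^k 𝔤)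
    (α : RawForm E M N) : RawForm E M j := fun a =>
  contract h (exteriorPower.map k (evalAt E a ∘ₗ v) p) (α a)

/-- A (homotopy) co-momentum map `(f)` of the infinitesimal action `v` on `(M, Ω)`, where `Ω` has
degree `n + 1` and `n = m + 1`: linear maps `f_i : Λⁱ 𝔤 → Ω^{n-i}(M)`, with `f_0 = f_{n+1} = 0`,
such that `f_1` takes values in Hamiltonian forms, `d f_1(x) = -ι_{v_x} Ω`, and
`-f_{k-1}(∂p) = d f_k(p) + ς(k) ι(v_p) Ω` for `1 ≤ k ≤ n + 1` and `p ∈ Λᵏ 𝔤`.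
The form degree `j = n - i` is carried as a separate index. -/
@[ext]
structure CoMomentum {m : ℕ} (Ω : Form E M (m + 2)) (v : 𝔤 →ₗ[ℝ] VField E M) where
  f : ∀ i j : ℕ, i + j = m + 1 → (⋀[ℝ]^i 𝔤 →ₗ[ℝ] Form E M j)
  f_zero : f 0 (m + 1) (Nat.zero_add _) = 0
  hamiltonian : ∀ p : ⋀[ℝ]^1 𝔤, IsHamiltonianForm Ω (f 1 m (Nat.add_comm 1 m) p)
  momentum : ∀ x : 𝔤,
    IsHamiltonianVF Ω (f 1 m (Nat.add_comm 1 m) (exteriorPower.ιMulti ℝ 1 ![x])) (v x)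
  /-- The equation for `k = i + 1 ≤ n`. -/
  main : ∀ (i j : ℕ) (h : i + (j + 1) = m + 1) (p : ⋀[ℝ]^(i + 1) 𝔤),
    -(f i (j + 1) h (boundary i p) : RawForm E M (j + 1)) =
      extD (f (i + 1) j (by omega) p : RawForm E M j)
        + sgn (i + 1) • iotaP (by omega) v p (Ω : RawForm E M (m + 2))
  /-- The equation for `k = n + 1`. -/
  main_top : ∀ p : ⋀[ℝ]^(m + 2) 𝔤,
    -(f (m + 1) 0 rfl (boundary (m + 1) p) : RawForm E M 0) =
      sgn (m + 2) • iotaP rfl v p (Ω : RawForm E M (m + 2))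

/-- `ℝ` as the abelian one-dimensional Lie algebra. -/
instance instLieRingReal : LieRing ℝ where
  bracket _ _ := 0
  add_lie _ _ _ := (add_zero 0).symm
  lie_add _ _ _ := (add_zero 0).symm
  lie_self _ := rfl
  leibniz_lie _ _ _ := (add_zero 0).symm

instance instLieAlgebraReal : LieAlgebra ℝ ℝ where
  lie_smul c _ _ := (smul_zero c).symm

/-- The extension of an action of `𝔤` to `𝔤 ⊕ ℝc` (the product Lie algebra `𝔤 × ℝ`, with
`c = (0, 1)`), by `c ↦ X`. -/
def extendAction (v : 𝔤 →ₗ[ℝ] VField E M) (X : VField E M) : 𝔤 × ℝ →ₗ[ℝ] VField E M :=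
  v.coprod (LinearMap.toSpanSingleton ℝ (VField E M) X)

/-- `p ⊗ c ∈ Λ^{k+1}(𝔤 ⊕ ℝc)` for `p ∈ Λᵏ 𝔤`. -/
def tensorC {k : ℕ} (p : ⋀[ℝ]^k 𝔤) : ⋀[ℝ]^(k + 1) (𝔤 × ℝ) :=
  wedgeVector (exteriorPower.map k (LinearMap.inl ℝ 𝔤 ℝ) p) ((0 : 𝔤), (1 : ℝ))

/-- `F` restricts to `f` on `Λ 𝔤`, and `F_k(p ⊗ c) = ς(k) ι(v_p) H` for `1 ≤ k ≤ n = m + 1` and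
`p ∈ Λ^{k-1} 𝔤`. -/
structure IsExtension {m : ℕ} {Ω : Form E M (m + 2)} {v : 𝔤 →ₗ[ℝ] VField E M} {X : VField E M}
    (f : CoMomentum Ω v) (H : Form E M m) (F : CoMomentum (𝔤 := 𝔤 × ℝ) Ω (extendAction v X)) : Prop where
  restrict : ∀ (i j : ℕ) (h : i + j = m + 1) (p : ⋀[ℝ]^i 𝔤),
    F.f i j h (exteriorPower.map i (LinearMap.inl ℝ 𝔤 ℝ) p) = f.f i j h p
  apply_tensorC : ∀ (i j : ℕ) (h : i + j = m) (p : ⋀[ℝ]^i 𝔤),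
    (F.f (i + 1) j (by omega) (tensorC p) : RawForm E M j) =
      sgn (i + 1) • iotaP h v p (H : RawForm E M m)

end Actions

end Multisymplectic

end

/-!
On graded forms let `ι(q)` denote contraction with `q ∈ Λ𝔤`, and let `ε` be the grading involution
of `Λ𝔤`. If every `v_x` preserves `α`, Cartan's formula extends from vectors to multivectors:
`d ι(q) α = ι(ε q) d α - ι(ε ∂q) α`.

An element of `Λ(𝔤 ⊕ ℝc)` is `p₀ + p₁ ∧ c` with `p₀, p₁ ∈ Λ𝔤`. As `d H = -ι_{v_H} Ω`, the term
`ι(p₁ ∧ c) Ω` is `ι(p₁) d H` up to sign, and the formula with `α = H` splits it into an exact form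
and a contraction of `H` with `∂p₁`. These are exactly the terms that `f̃(p ⊗ c) = ς ι(v_p) H`
contributes to the equations of a co-momentum map. The decomposition also gives uniqueness.

If `∂p = 0`, then `d ι(p) H = ± ι(p) d H`, which `ι_{v_H}` annihilates because
`ι_{v_H} ι_{v_H} Ω = 0`; so `L_{v_H} ι(p) H = d ι_{v_H} ι(p) H`. That `v_H` commutes with every
`v_x` follows by contracting `Ω` with `[v_x, v_H]` and using that `Ω` is nondegenerate.
-/

noncomputable section

namespace Multisymplectic

/-! ### Forms on a normed space -/

section NormedSpace

variable {E : Type*} [NormedAddCommGroup E] [NormedSpace ℝ E] {k : ℕ}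

/-- The interior product as a bounded bilinear map, through which it is differentiated. -/
def interiorCLM (E : Type*) [NormedAddCommGroup E] [NormedSpace ℝ E] (k : ℕ) :
    (E [⋀^Fin (k + 1)]→L[ℝ] ℝ) →L[ℝ] E →L[ℝ] E [⋀^Fin k]→L[ℝ] ℝ :=
  (ContinuousAlternatingMap.curryLeftLI (𝕜 := ℝ)).toContinuousLinearMap

theorem interior_eq_interiorCLM (X : E) (a : E [⋀^Fin (k + 1)]→L[ℝ] ℝ) :
    interior X a = interiorCLM E k a X := rfl

theorem interior_apply (X : E) (a : E [⋀^Fin (k + 1)]→L[ℝ] ℝ) (w : Fin k → E) :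
    interior X a w = a (Fin.cons X w) := rfl

theorem interior_interior_self (X : E) (a : E [⋀^Fin (k + 2)]→L[ℝ] ℝ) :
    interior X (interior X a) = 0 := by
  ext w
  exact a.map_eq_zero_of_eq _ (i := 0) (j := 1) rfl (by simp)

theorem interior_compContinuousLinearMap {F : Type*} [NormedAddCommGroup F] [NormedSpace ℝ F]
    (A : E →L[ℝ] F) (X : E) (a : F [⋀^Fin (k + 1)]→L[ℝ] ℝ) :
    interior X (a.compContinuousLinearMap A) =
      (interior (A X) a).compContinuousLinearMap A := by
  ext w
  exact congrArg a (Fin.comp_cons A X w)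

variable {X Y : E → E} {x : E}

theorem hasFDerivAt_interior {α : E → E [⋀^Fin (k + 1)]→L[ℝ] ℝ}
    (hX : DifferentiableAt ℝ X x) (hα : DifferentiableAt ℝ α x) :
    HasFDerivAt (fun y => interior (X y) (α y))
      ((interiorCLM E k).precompR E (α x) (fderiv ℝ X x) +
        (interiorCLM E k).precompL E (fderiv ℝ α x) (X x)) x :=
  (interiorCLM E k).hasFDerivAt_of_bilinear hα.hasFDerivAt hX.hasFDerivAt

theorem fderiv_interior_apply {α : E → E [⋀^Fin (k + 1)]→L[ℝ] ℝ}
    (hX : DifferentiableAt ℝ X x) (hα : DifferentiableAt ℝ α x) (u : E) (w : Fin k → E) :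
    fderiv ℝ (fun y => interior (X y) (α y)) x u w =
      α x (Fin.cons (fderiv ℝ X x u) w) + fderiv ℝ α x u (Fin.cons (X x) w) := by
  rw [(hasFDerivAt_interior hX hα).fderiv]
  rfl

theorem contDiffOn_interior {n : WithTop ℕ∞} {s : Set E} {α : E → E [⋀^Fin (k + 1)]→L[ℝ] ℝ}
    (hX : ContDiffOn ℝ n X s) (hα : ContDiffOn ℝ n α s) :
    ContDiffOn ℝ n (fun y => interior (X y) (α y)) s :=
  (interiorCLM E k).isBoundedBilinearMap.contDiff.comp_contDiffOn (hα.prodMk hX)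

variable {α : E → E [⋀^Fin k]→L[ℝ] ℝ}

theorem contDiffOn_extDeriv {s : Set E} (hs : IsOpen s) (hα : ContDiffOn ℝ ∞ α s) :
    ContDiffOn ℝ ∞ (extDeriv α) s :=
  (ContinuousAlternatingMap.alternatizeUncurryFinCLM ℝ E ℝ).contDiff.comp_contDiffOn
    (hα.fderiv_of_isOpen hs (by simp))

theorem interior_extDeriv_apply (hα : DifferentiableAt ℝ α x) (u : E) (w : Fin k → E) :
    interior u (extDeriv α x) w = fderiv ℝ α x u w -
      ∑ i : Fin k, (-1 : ℝ) ^ (i : ℕ) *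
        fderiv ℝ α x (w i) (i.succ.removeNth (Fin.cons u w : Fin (k + 1) → E)) := by
  rw [interior_apply, extDeriv_apply hα, Fin.sum_univ_succ, sub_eq_add_neg,
    ← Finset.sum_neg_distrib]
  simp [pow_succ, fderiv_continuousAlternatingMap_apply_const_apply hα]

/-- The Lie derivative `L_X α` on a normed space, by Cartan's formula `L_X = d ι_X + ι_X d`
(`L_X = ι_X d` on functions); the counterpart of `lieD` in a chart. -/
def lieDeriv : ∀ {k : ℕ}, (E → E) → (E → E [⋀^Fin k]→L[ℝ] ℝ) → E → E [⋀^Fin k]→L[ℝ] ℝ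
  | 0, X, α => fun x => interior (X x) (extDeriv α x)
  | _ + 1, X, α => fun x =>
      extDeriv (fun y => interior (X y) (α y)) x + interior (X x) (extDeriv α x)

theorem lieDeriv_congr {β : E → E [⋀^Fin k]→L[ℝ] ℝ} (h : α =ᶠ[nhds x] β) :
    lieDeriv X α x = lieDeriv X β x := by
  cases k with
  | zero => simp only [lieDeriv, h.extDeriv_eq]
  | succ k =>
    have h' : (fun y => interior (X y) (α y)) =ᶠ[nhds x] fun y => interior (X y) (β y) :=
      h.mono fun y hy => by simp only [hy]
    simp only [lieDeriv, h.extDeriv_eq, h'.extDeriv_eq]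

theorem apply_update_eq_apply_cons_removeNth (a : E [⋀^Fin (k + 1)]→L[ℝ] ℝ)
    (w : Fin (k + 1) → E) (i : Fin (k + 1)) (y : E) :
    a (Function.update w i y) = (-1 : ℝ) ^ (i : ℕ) * a (Fin.cons y (i.removeNth w)) := by
  rw [← Fin.insertNth_removeNth, ContinuousAlternatingMap.map_insertNth]
  simp [Matrix.vecCons]

theorem lieDeriv_apply (hX : DifferentiableAt ℝ X x) (hα : DifferentiableAt ℝ α x)
    (w : Fin k → E) :
    lieDeriv X α x w = fderiv ℝ α x (X x) w +
      ∑ i : Fin k, α x (Function.update w i (fderiv ℝ X x (w i))) := by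
  cases k with
  | zero => simp [lieDeriv, interior_extDeriv_apply hα]
  | succ k =>
    have hι := (hasFDerivAt_interior hX hα).differentiableAt
    have hcons (i : Fin (k + 1)) : i.succ.removeNth (Fin.cons (X x) w : Fin (k + 2) → E) =
        Fin.cons (X x) (i.removeNth w) := by
      funext l
      cases l using Fin.cases <;> simp [Fin.removeNth]
    rw [lieDeriv, ContinuousAlternatingMap.add_apply, interior_extDeriv_apply hα,
      extDeriv_apply hι]
    simp only [fderiv_continuousAlternatingMap_apply_const_apply hι, fderiv_interior_apply hX hα,
      hcons, apply_update_eq_apply_cons_removeNth, smul_add, Finset.sum_add_distrib, zsmul_eq_mul]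
    push_cast
    ring

theorem lieDeriv_interior {α : E → E [⋀^Fin (k + 1)]→L[ℝ] ℝ} (hX : DifferentiableAt ℝ X x)
    (hY : DifferentiableAt ℝ Y x) (hα : DifferentiableAt ℝ α x) :
    lieDeriv X (fun y => interior (Y y) (α y)) x =
      interior (Y x) (lieDeriv X α x) + interior (VectorField.lieBracket ℝ X Y x) (α x) := by
  ext w
  have hsub : interior (VectorField.lieBracket ℝ X Y x) (α x) w =
      α x (Fin.cons (fderiv ℝ Y x (X x)) w) - α x (Fin.cons (fderiv ℝ X x (Y x)) w) := by
    rw [interior_eq_interiorCLM, VectorField.lieBracket, map_sub]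
    rfl
  rw [lieDeriv_apply hX (hasFDerivAt_interior hY hα).differentiableAt,
    ContinuousAlternatingMap.add_apply, hsub, interior_apply, lieDeriv_apply hX hα,
    fderiv_interior_apply hY hα, Fin.sum_univ_succ]
  simp only [Fin.cons_zero, Fin.cons_succ, Fin.update_cons_zero, ← Fin.cons_update,
    interior_apply]
  ring

end NormedSpace

/-! ### Forms and vector fields in a chart -/

section Charts

variable {E : Type*} [NormedAddCommGroup E] [NormedSpace ℝ E]
  {M : Type*} [TopologicalSpace M] [ChartedSpace E M] {k : ℕ} {x₀ x : M} {y : E}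

variable (E) in
/-- The derivative at `x` of the chart around `x₀`. The tangent spaces of `M` are identified with
the model space `E`, to which they are definitionally equal. -/
def chartD (x₀ x : M) : E →L[ℝ] E := mfderiv 𝓘(ℝ, E) 𝓘(ℝ, E) (extChartAt 𝓘(ℝ, E) x₀) x

/-- The derivative at `y` of the inverse of the chart around `x₀`, with the same identification
as in `chartD`. -/
def chartSymmD (x₀ : M) (y : E) : E →L[ℝ] E :=
  mfderiv 𝓘(ℝ, E) 𝓘(ℝ, E) (extChartAt 𝓘(ℝ, E) x₀).symm y

/-- The value at `x` of a form, as a form on the model space. -/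
def formAt (α : RawForm E M k) (x : M) : E [⋀^Fin k]→L[ℝ] ℝ := α x

theorem chartRep_eq_comp_chartSymmD (x₀ : M) (α : RawForm E M k) (y : E) :
    chartRep x₀ α y =
      (formAt α ((extChartAt 𝓘(ℝ, E) x₀).symm y)).compContinuousLinearMap (chartSymmD x₀ y) := rfl

theorem formAt_extD (α : RawForm E M k) (x : M) :
    formAt (extD α) x = (extDeriv (chartRep x α)
      (extChartAt 𝓘(ℝ, E) x x)).compContinuousLinearMap (chartD E x x) := rfl

theorem chartRep_add (x₀ : M) (α β : RawForm E M k) :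
    chartRep x₀ (α + β) = chartRep x₀ α + chartRep x₀ β := rfl

theorem chartRep_smul (x₀ : M) (c : ℝ) (α : RawForm E M k) :
    chartRep x₀ (c • α) = c • chartRep x₀ α := rfl

theorem eventually_mem_target (hy : y ∈ (extChartAt 𝓘(ℝ, E) x₀).target) :
    ∀ᶠ y' in nhds y, y' ∈ (extChartAt 𝓘(ℝ, E) x₀).target :=
  (isOpen_extChartAt_target x₀).mem_nhds hy

theorem Form.contDiffAt_chartRep {α : RawForm E M k} (hα : α ∈ Form E M k)
    (hy : y ∈ (extChartAt 𝓘(ℝ, E) x₀).target) : ContDiffAt ℝ ∞ (chartRep x₀ α) y :=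
  (hα x₀).contDiffAt (eventually_mem_target hy)

theorem Form.differentiableAt_chartRep {α : RawForm E M k} (hα : α ∈ Form E M k)
    (hy : y ∈ (extChartAt 𝓘(ℝ, E) x₀).target) : DifferentiableAt ℝ (chartRep x₀ α) y :=
  (Form.contDiffAt_chartRep hα hy).differentiableAt (by simp)

/-- The transition map from the chart around `x₀` to the chart around `x`. -/
def transition (x₀ x : M) : E → E := extChartAt 𝓘(ℝ, E) x ∘ (extChartAt 𝓘(ℝ, E) x₀).symm

theorem two_le_infty : minSmoothness ℝ 2 ≤ (∞ : WithTop ℕ∞) := by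
  rw [minSmoothness_of_isRCLikeNormedField]
  exact WithTop.coe_le_coe.2 (le_top : (2 : ℕ∞) ≤ ⊤)

variable [IsManifold 𝓘(ℝ, E) ∞ M]

theorem chartD_comp_chartSymmD (hy : y ∈ (extChartAt 𝓘(ℝ, E) x₀).target) :
    (chartD E x₀ ((extChartAt 𝓘(ℝ, E) x₀).symm y)).comp (chartSymmD x₀ y) =
      ContinuousLinearMap.id ℝ E := by
  have h := mfderiv_extChartAt_comp_mfderivWithin_extChartAt_symm (I := 𝓘(ℝ, E)) hy
  rwa [ModelWithCorners.range_eq_univ, mfderivWithin_univ] at h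

theorem chartSymmD_comp_chartD (hx : x ∈ (extChartAt 𝓘(ℝ, E) x₀).source) :
    (chartSymmD x₀ (extChartAt 𝓘(ℝ, E) x₀ x)).comp (chartD E x₀ x) =
      ContinuousLinearMap.id ℝ E := by
  have h := mfderivWithin_extChartAt_symm_comp_mfderiv_extChartAt' (I := 𝓘(ℝ, E)) hx
  rwa [ModelWithCorners.range_eq_univ, mfderivWithin_univ] at h

theorem formAt_eq_chartRep_comp_chartD (α : RawForm E M k)
    (hx : x ∈ (extChartAt 𝓘(ℝ, E) x₀).source) :
    formAt α x = (chartRep x₀ α (extChartAt 𝓘(ℝ, E) x₀ x)).compContinuousLinearMap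
      (chartD E x₀ x) := by
  rw [chartRep_eq_comp_chartSymmD, (extChartAt 𝓘(ℝ, E) x₀).left_inv hx]
  ext w
  exact congrArg (formAt α x)
    (funext fun i => (DFunLike.congr_fun (chartSymmD_comp_chartD hx) (w i)).symm)

theorem RawForm.ext_chartRep {α β : RawForm E M k}
    (h : ∀ x : M, chartRep x α (extChartAt 𝓘(ℝ, E) x x) = chartRep x β (extChartAt 𝓘(ℝ, E) x x)) :
    α = β := by
  funext x
  have hx := mem_extChartAt_source (I := 𝓘(ℝ, E)) x
  exact (formAt_eq_chartRep_comp_chartD α hx).trans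
    ((h x).symm ▸ (formAt_eq_chartRep_comp_chartD β hx).symm)

theorem hasFDerivAt_transition (hy : y ∈ (extChartAt 𝓘(ℝ, E) x₀).target)
    (hx : (extChartAt 𝓘(ℝ, E) x₀).symm y ∈ (extChartAt 𝓘(ℝ, E) x).source) :
    HasFDerivAt (transition x₀ x)
      ((chartD E x ((extChartAt 𝓘(ℝ, E) x₀).symm y)).comp (chartSymmD x₀ y)) y := by
  have h₁ := mdifferentiableWithinAt_extChartAt_symm (I := 𝓘(ℝ, E)) hy
  rw [ModelWithCorners.range_eq_univ, mdifferentiableWithinAt_univ] at h₁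
  have h₂ := mdifferentiableAt_extChartAt (I := 𝓘(ℝ, E)) (extChartAt_source 𝓘(ℝ, E) x ▸ hx)
  exact (h₂.hasMFDerivAt.comp y h₁.hasMFDerivAt).hasFDerivAt

theorem contMDiffAt_extChartAt_symm (hy : y ∈ (extChartAt 𝓘(ℝ, E) x₀).target) :
    ContMDiffAt 𝓘(ℝ, E) 𝓘(ℝ, E) ∞ (extChartAt 𝓘(ℝ, E) x₀).symm y :=
  (contMDiffOn_extChartAt_symm x₀).contMDiffAt (eventually_mem_target hy)

theorem contDiffAt_transition (hy : y ∈ (extChartAt 𝓘(ℝ, E) x₀).target)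
    (hx : (extChartAt 𝓘(ℝ, E) x₀).symm y ∈ (extChartAt 𝓘(ℝ, E) x).source) :
    ContDiffAt ℝ ∞ (transition x₀ x) y :=
  ((contMDiffAt_extChartAt' (extChartAt_source 𝓘(ℝ, E) x ▸ hx)).comp y
    (contMDiffAt_extChartAt_symm hy)).contDiffAt

theorem chartRep_eq_pullback_transition (α : RawForm E M k)
    (hy : y ∈ (extChartAt 𝓘(ℝ, E) x₀).target)
    (hx : (extChartAt 𝓘(ℝ, E) x₀).symm y ∈ (extChartAt 𝓘(ℝ, E) x).source) :
    chartRep x₀ α y = (chartRep x α (transition x₀ x y)).compContinuousLinearMap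
      (fderiv ℝ (transition x₀ x) y) := by
  rw [(hasFDerivAt_transition hy hx).fderiv, chartRep_eq_comp_chartSymmD,
    formAt_eq_chartRep_comp_chartD α hx]
  rfl

theorem chartRep_extD {α : RawForm E M k} (hα : α ∈ Form E M k)
    (hy : y ∈ (extChartAt 𝓘(ℝ, E) x₀).target) :
    chartRep x₀ (extD α) y = extDeriv (chartRep x₀ α) y := by
  obtain ⟨x, hxy⟩ : ∃ x, x = (extChartAt 𝓘(ℝ, E) x₀).symm y := ⟨_, rfl⟩
  have hx : (extChartAt 𝓘(ℝ, E) x₀).symm y ∈ (extChartAt 𝓘(ℝ, E) x).source :=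
    hxy ▸ mem_extChartAt_source x
  have hpullback : chartRep x₀ α =ᶠ[nhds y] fun y' =>
      (chartRep x α (transition x₀ x y')).compContinuousLinearMap
        (fderiv ℝ (transition x₀ x) y') := by
    filter_upwards [eventually_mem_target hy, (continuousAt_extChartAt_symm'' hy).preimage_mem_nhds
      ((isOpen_extChartAt_source x).mem_nhds hx)] with y' hy' hx'
    exact chartRep_eq_pullback_transition α hy' hx'
  have htransition : transition x₀ x y = extChartAt 𝓘(ℝ, E) x x :=
    congrArg (extChartAt 𝓘(ℝ, E) x) hxy.symm
  have hα' := Form.differentiableAt_chartRep hα (mem_extChartAt_target (I := 𝓘(ℝ, E)) x)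
  rw [hpullback.extDeriv_eq, extDeriv_pullback (htransition ▸ hα') (contDiffAt_transition hy hx)
    two_le_infty, (hasFDerivAt_transition hy hx).fderiv, chartRep_eq_comp_chartSymmD,
    htransition, ← hxy, formAt_extD]
  rfl

theorem extD_mem {α : RawForm E M k} (hα : α ∈ Form E M k) : extD α ∈ Form E M (k + 1) :=
  fun x₀ => (contDiffOn_extDeriv (isOpen_extChartAt_target x₀) (hα x₀)).congr
    fun _ hy => chartRep_extD hα hy

theorem extD_add {α β : RawForm E M k} (hα : α ∈ Form E M k) (hβ : β ∈ Form E M k) :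
    extD (α + β) = extD α + extD β := by
  refine RawForm.ext_chartRep fun x => ?_
  have hx := mem_extChartAt_target (I := 𝓘(ℝ, E)) x
  rw [chartRep_extD ((Form E M k).add_mem hα hβ) hx, chartRep_add, chartRep_add, Pi.add_apply,
    chartRep_extD hα hx, chartRep_extD hβ hx]
  exact extDeriv_add (Form.differentiableAt_chartRep hα hx) (Form.differentiableAt_chartRep hβ hx)

theorem extD_smul {α : RawForm E M k} (c : ℝ) (hα : α ∈ Form E M k) :
    extD (c • α) = c • extD α := by
  refine RawForm.ext_chartRep fun x => ?_
  have hx := mem_extChartAt_target (I := 𝓘(ℝ, E)) x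
  rw [chartRep_extD ((Form E M k).smul_mem c hα) hx, chartRep_smul, chartRep_smul, Pi.smul_apply,
    chartRep_extD hα hx]
  exact extDeriv_smul c _

theorem extD_extD {α : RawForm E M k} (hα : α ∈ Form E M k) : extD (extD α) = 0 := by
  refine RawForm.ext_chartRep fun x => ?_
  have hx := mem_extChartAt_target (I := 𝓘(ℝ, E)) x
  have hd := (eventually_mem_target hx).mono fun y hy => chartRep_extD hα hy
  rw [chartRep_extD (extD_mem hα) hx, Filter.EventuallyEq.extDeriv_eq hd,
    extDeriv_extDeriv_apply (Form.contDiffAt_chartRep hα hx) two_le_infty]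
  rfl

/-- The value at `x` of a vector field, as a vector of the model space. -/
def fieldAt (X : VField E M) (x : M) : E := X x

/-- The expression of a vector field in the chart around `x₀`; the counterpart of `chartRep`. -/
def fieldRep (x₀ : M) (X : VField E M) (y : E) : E :=
  chartD E x₀ ((extChartAt 𝓘(ℝ, E) x₀).symm y) (fieldAt X ((extChartAt 𝓘(ℝ, E) x₀).symm y))

theorem formAt_iota (X : VField E M) (α : RawForm E M (k + 1)) (x : M) :
    formAt (iota X α) x = interior (fieldAt X x) (formAt α x) := rfl

theorem chartSymmD_fieldRep (X : VField E M) (hy : y ∈ (extChartAt 𝓘(ℝ, E) x₀).target) :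
    chartSymmD x₀ y (fieldRep x₀ X y) = fieldAt X ((extChartAt 𝓘(ℝ, E) x₀).symm y) := by
  have h := chartSymmD_comp_chartD (E := E) ((extChartAt 𝓘(ℝ, E) x₀).map_target hy)
  rw [(extChartAt 𝓘(ℝ, E) x₀).right_inv hy] at h
  exact DFunLike.congr_fun h _

theorem chartRep_iota (X : VField E M) (α : RawForm E M (k + 1))
    (hy : y ∈ (extChartAt 𝓘(ℝ, E) x₀).target) :
    chartRep x₀ (iota X α) y = interior (fieldRep x₀ X y) (chartRep x₀ α y) := by
  rw [chartRep_eq_comp_chartSymmD, chartRep_eq_comp_chartSymmD, formAt_iota,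
    interior_compContinuousLinearMap, chartSymmD_fieldRep X hy]

theorem contDiffAt_fieldRep (X : VField E M) (hy : y ∈ (extChartAt 𝓘(ℝ, E) x₀).target) :
    ContDiffAt ℝ ∞ (fieldRep x₀ X) y := by
  have hsource (y' : E) (hy' : y' ∈ (extChartAt 𝓘(ℝ, E) x₀).target) :
      (extChartAt 𝓘(ℝ, E) x₀).symm y' ∈ (chartAt E x₀).source :=
    extChartAt_source 𝓘(ℝ, E) x₀ ▸ (extChartAt 𝓘(ℝ, E) x₀).map_target hy'
  let e := trivializationAt E (TangentSpace 𝓘(ℝ, E) : M → Type _) x₀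
  have he : ContMDiffAt 𝓘(ℝ, E) 𝓘(ℝ, E) ∞
      (fun x => (e ⟨x, X x⟩).2) ((extChartAt 𝓘(ℝ, E) x₀).symm y) :=
    (e.contMDiffAt_section_iff (hsource y hy)).1 (X.contMDiff_toFun _)
  refine (he.comp y (contMDiffAt_extChartAt_symm hy)).contDiffAt.congr_of_eventuallyEq ?_
  filter_upwards [eventually_mem_target hy] with y' hy'
  have hD := TangentBundle.continuousLinearMapAt_trivializationAt (I := 𝓘(ℝ, E)) (hsource y' hy')
  exact (DFunLike.congr_fun hD _).symm.trans
    (e.continuousLinearMapAt_apply_of_mem ℝ (hsource y' hy') _)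

theorem iota_mem (X : VField E M) {α : RawForm E M (k + 1)} (hα : α ∈ Form E M (k + 1)) :
    iota X α ∈ Form E M k := fun x₀ =>
  (contDiffOn_interior (fun _ hy => (contDiffAt_fieldRep X hy).contDiffWithinAt) (hα x₀)).congr
    fun _ hy => chartRep_iota X α hy

theorem chartRep_lieD (X : VField E M) {α : RawForm E M k} (hα : α ∈ Form E M k)
    (hy : y ∈ (extChartAt 𝓘(ℝ, E) x₀).target) :
    chartRep x₀ (lieD X α) y = lieDeriv (fieldRep x₀ X) (chartRep x₀ α) y := by
  cases k with
  | zero => rw [lieD, lieDeriv, chartRep_iota _ _ hy, chartRep_extD hα hy]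
  | succ k =>
    have hι := (eventually_mem_target hy).mono fun y' hy' => chartRep_iota X α hy'
    rw [lieD, lieDeriv, chartRep_add, Pi.add_apply, chartRep_iota _ _ hy, chartRep_extD hα hy,
      chartRep_extD (iota_mem X hα) hy, Filter.EventuallyEq.extDeriv_eq hι]

theorem mpullback_extChartAt_symm_eq_fieldRep (X : VField E M)
    (hy : y ∈ (extChartAt 𝓘(ℝ, E) x₀).target) :
    VectorField.mpullback 𝓘(ℝ, E) 𝓘(ℝ, E) (extChartAt 𝓘(ℝ, E) x₀).symm X y = fieldRep x₀ X y := by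
  have h := chartSymmD_comp_chartD (E := E) ((extChartAt 𝓘(ℝ, E) x₀).map_target hy)
  rw [(extChartAt 𝓘(ℝ, E) x₀).right_inv hy] at h
  exact DFunLike.congr_fun (ContinuousLinearMap.inverse_eq h (chartD_comp_chartSymmD hy)) _

theorem mlieBracket_eq_chartSymmD_lieBracket (x : M) (X Y : VField E M) :
    (VectorField.mlieBracket 𝓘(ℝ, E) X Y x : E) =
      chartSymmD x (extChartAt 𝓘(ℝ, E) x x)
        (VectorField.lieBracket ℝ (fieldRep x X) (fieldRep x Y) (extChartAt 𝓘(ℝ, E) x x)) := by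
  have hx := mem_extChartAt_target (I := 𝓘(ℝ, E)) x
  have hpullback (Z : VField E M) :=
    (eventually_mem_target hx).mono fun y hy => mpullback_extChartAt_symm_eq_fieldRep Z hy
  have hinv : (chartD E x x).inverse = chartSymmD x (extChartAt 𝓘(ℝ, E) x x) := by
    have h := chartD_comp_chartSymmD (E := E) hx
    rw [extChartAt_to_inv] at h
    exact ContinuousLinearMap.inverse_eq h (chartSymmD_comp_chartD (mem_extChartAt_source x))
  rw [← VectorField.mlieBracketWithin_univ, VectorField.mlieBracketWithin_apply, ← hinv]
  simp only [Set.preimage_univ, Set.univ_inter, ModelWithCorners.range_eq_univ,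
    VectorField.mpullbackWithin_univ]
  exact congrArg (chartD E x x).inverse ((congrFun VectorField.lieBracketWithin_univ _).trans
    (Filter.EventuallyEq.lieBracket_vectorField_eq (hpullback X) (hpullback Y)))

/-- `ι_{[X, Y]} α`, for the bracket of vector fields. -/
def iotaBracket (X Y : VField E M) (α : RawForm E M (k + 1)) : RawForm E M k := fun x =>
  interior (VectorField.mlieBracket 𝓘(ℝ, E) X Y x) (α x)

theorem chartRep_iotaBracket (X Y : VField E M) (α : RawForm E M (k + 1)) (x : M) :
    chartRep x (iotaBracket X Y α) (extChartAt 𝓘(ℝ, E) x x) =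
      interior (VectorField.lieBracket ℝ (fieldRep x X) (fieldRep x Y) (extChartAt 𝓘(ℝ, E) x x))
        (chartRep x α (extChartAt 𝓘(ℝ, E) x x)) := by
  rw [chartRep_eq_comp_chartSymmD, chartRep_eq_comp_chartSymmD, interior_compContinuousLinearMap,
    ← mlieBracket_eq_chartSymmD_lieBracket, extChartAt_to_inv]
  rfl

theorem lieD_iota (X Y : VField E M) {α : RawForm E M (k + 1)} (hα : α ∈ Form E M (k + 1)) :
    lieD X (iota Y α) = iota Y (lieD X α) + iotaBracket X Y α := by
  refine RawForm.ext_chartRep fun x => ?_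
  have hx := mem_extChartAt_target (I := 𝓘(ℝ, E)) x
  have hι := (eventually_mem_target hx).mono fun y hy => chartRep_iota Y α hy
  rw [chartRep_lieD X (iota_mem Y hα) hx, chartRep_add, Pi.add_apply, chartRep_iota _ _ hx,
    chartRep_lieD X hα hx, chartRep_iotaBracket, lieDeriv_congr hι]
  exact lieDeriv_interior ((contDiffAt_fieldRep X hx).differentiableAt (by simp))
    ((contDiffAt_fieldRep Y hx).differentiableAt (by simp)) (Form.differentiableAt_chartRep hα hx)

end Charts

/-! ### Exterior algebras -/

section ExteriorAlgebra

open ExteriorAlgebra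

variable {R V W : Type*} [CommRing R] [AddCommGroup V] [Module R V] [AddCommGroup W] [Module R W]

@[elab_as_elim]
theorem exteriorAlgebra_left_induction {P : ExteriorAlgebra R V → Prop}
    (algebraMap : ∀ r : R, P (algebraMap _ _ r)) (add : ∀ x y, P x → P y → P (x + y))
    (ι_mul : ∀ x m, P x → P (ι R m * x)) : ∀ x, P x := fun x =>
  CliffordAlgebra.left_induction (P := P) (0 : QuadraticForm R V) algebraMap add ι_mul x

@[elab_as_elim]
theorem exteriorAlgebra_right_induction {P : ExteriorAlgebra R V → Prop}
    (algebraMap : ∀ r : R, P (algebraMap _ _ r)) (add : ∀ x y, P x → P y → P (x + y))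
    (mul_ι : ∀ m x, P x → P (x * ι R m)) : ∀ x, P x := fun x =>
  CliffordAlgebra.right_induction (P := P) (0 : QuadraticForm R V) algebraMap add mul_ι x

theorem ι_mul_ι_swap (x y : V) : ι R x * ι R y = -(ι R y * ι R x) :=
  eq_neg_of_add_eq_zero_left (ι_add_mul_swap x y)

variable (R V) in
/-- The grade involution of the exterior algebra, which is `(-1)ᵏ` on the `k`-th power. -/
def parity : ExteriorAlgebra R V →ₐ[R] ExteriorAlgebra R V := CliffordAlgebra.involute

theorem parity_ι (x : V) : parity R V (ι R x) = -ι R x := CliffordAlgebra.involute_ι x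

theorem parity_parity (q : ExteriorAlgebra R V) : parity R V (parity R V q) = q :=
  CliffordAlgebra.involute_involute q

theorem mul_ι_eq_ι_mul_parity (q : ExteriorAlgebra R V) (z : V) :
    q * ι R z = ι R z * parity R V q := by
  induction q using exteriorAlgebra_left_induction with
  | algebraMap r => rw [AlgHom.commutes, Algebra.commutes]
  | add a b ha hb => rw [add_mul, ha, hb, map_add, mul_add]
  | ι_mul q y h =>
    rw [mul_assoc, h, ← mul_assoc, ι_mul_ι_swap, map_mul, parity_ι, neg_mul, neg_mul, mul_neg,
      mul_assoc]

theorem parity_map (φ : V →ₗ[R] W) (q : ExteriorAlgebra R V) :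
    parity R W (ExteriorAlgebra.map φ q) = ExteriorAlgebra.map φ (parity R V q) := by
  induction q using exteriorAlgebra_left_induction with
  | algebraMap r => simp only [AlgHom.commutes]
  | add a b ha hb => simp only [map_add, ha, hb]
  | ι_mul q z h => simp only [map_mul, map_apply_ι, parity_ι, h, map_neg]

theorem parity_ιMulti {k : ℕ} (x : Fin k → V) :
    parity R V (ιMulti R k x) = (-1 : R) ^ k • ιMulti R k x := by
  induction k with
  | zero => rw [ιMulti_zero_apply, map_one, pow_zero, one_smul]
  | succ k ih =>
    rw [ιMulti_succ_apply, map_mul, parity_ι, ih, mul_smul_comm, pow_succ', mul_smul, neg_mul,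
      smul_neg, neg_one_smul]

theorem parity_coe {k : ℕ} (p : ⋀[R]^k V) :
    parity R V (p : ExteriorAlgebra R V) = (-1 : R) ^ k • (p : ExteriorAlgebra R V) := by
  have : (parity R V).toLinearMap ∘ₗ (⋀[R]^k V).subtype = (-1 : R) ^ k • (⋀[R]^k V).subtype := by
    apply exteriorPower.linearMap_ext
    ext x
    exact parity_ιMulti x
  exact LinearMap.congr_fun this p

theorem coe_exteriorPower_map (k : ℕ) (φ : V →ₗ[R] W) (p : ⋀[R]^k V) :
    (exteriorPower.map k φ p : ExteriorAlgebra R W) = ExteriorAlgebra.map φ p := by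
  have : (⋀[R]^k W).subtype ∘ₗ exteriorPower.map k φ =
      (ExteriorAlgebra.map φ).toLinearMap ∘ₗ (⋀[R]^k V).subtype := by
    apply exteriorPower.linearMap_ext
    ext x
    simp [ExteriorAlgebra.map_apply_ιMulti]
  exact LinearMap.congr_fun this p

theorem exists_algebraMap_eq_coe (p : ⋀[R]^0 V) :
    ∃ r : R, algebraMap R (ExteriorAlgebra R V) r = p := by
  obtain ⟨p, hp⟩ := p
  rwa [exteriorPower, pow_zero, Submodule.mem_one] at hp

theorem contractRight_mem {k : ℕ} {q : ExteriorAlgebra R V} (hq : q ∈ ⋀[R]^(k + 1) V)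
    (d : Module.Dual R V) :
    CliffordAlgebra.contractRight (Q := (0 : QuadraticForm R V)) q d ∈ ⋀[R]^k V := by
  induction k generalizing q with
  | zero =>
    rw [exteriorPower, zero_add, pow_one] at hq
    obtain ⟨x, rfl⟩ := hq
    rw [exteriorPower, pow_zero, Submodule.mem_one]
    exact ⟨d x, (CliffordAlgebra.contractRight_ι (Q := (0 : QuadraticForm R V)) d x).symm⟩
  | succ k ih =>
    rw [exteriorPower, pow_succ] at hq
    induction hq using Submodule.mul_induction_on' with
    | mem_mul_mem a ha b hb =>
      obtain ⟨x, rfl⟩ := hb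
      rw [show CliffordAlgebra.contractRight (Q := (0 : QuadraticForm R V)) (a * ι R x) d = _ from
        CliffordAlgebra.contractRight_mul_ι d x a]
      refine Submodule.sub_mem _ (Submodule.smul_mem _ _ ha) ?_
      rw [exteriorPower, pow_succ]
      exact Submodule.mul_mem_mul (ih ha) ⟨x, rfl⟩
    | add a _ b _ ha hb =>
      rw [show CliffordAlgebra.contractRight (Q := (0 : QuadraticForm R V)) (a + b) d = _ from
        LinearMap.map_add₂ _ a b d]
      exact Submodule.add_mem _ ha hb

end ExteriorAlgebra

section Prod

open ExteriorAlgebra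

variable {R V : Type*} [CommRing R] [AddCommGroup V] [Module R V]

variable (R V) in
/-- The map of exterior algebras induced by the inclusion `V → V ⊕ Rc`. -/
def inlExt : ExteriorAlgebra R V →ₐ[R] ExteriorAlgebra R (V × R) :=
  ExteriorAlgebra.map (LinearMap.inl R V R)

variable (R V) in
/-- The map of exterior algebras induced by the projection `V ⊕ Rc → V`. -/
def fstExt : ExteriorAlgebra R (V × R) →ₐ[R] ExteriorAlgebra R V :=
  ExteriorAlgebra.map (LinearMap.fst R V R)

variable (R V) in
/-- The component `q₁` in the decomposition `q = q₀ + q₁ ∧ c` of `Λ(V ⊕ Rc)`, where `c = (0, 1)`: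
the right contraction with the coordinate functional of `c`, projected to `Λ V`. -/
def cPart : ExteriorAlgebra R (V × R) →ₗ[R] ExteriorAlgebra R V :=
  (fstExt R V).toLinearMap ∘ₗ
    (CliffordAlgebra.contractRight (Q := (0 : QuadraticForm R (V × R)))).flip
      (LinearMap.snd R V R)

theorem fstExt_inlExt (q : ExteriorAlgebra R V) : fstExt R V (inlExt R V q) = q := by
  have : (fstExt R V).comp (inlExt R V) = AlgHom.id R _ := by
    rw [fstExt, inlExt, ExteriorAlgebra.map_comp_map, LinearMap.fst_comp_inl,
      ExteriorAlgebra.map_id]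
  exact DFunLike.congr_fun this q

theorem fstExt_ι (x : V × R) : fstExt R V (ι R x) = ι R x.1 := map_apply_ι _ _

theorem inlExt_ι (x : V) : inlExt R V (ι R x) = ι R (x, (0 : R)) := map_apply_ι _ _

theorem cPart_algebraMap (r : R) : cPart R V (algebraMap R _ r) = 0 :=
  (congrArg (fstExt R V) (CliffordAlgebra.contractRight_algebraMap _ _ r)).trans (map_zero _)

theorem cPart_mul_ι (q : ExteriorAlgebra R (V × R)) (x : V × R) :
    cPart R V (q * ι R x) = x.2 • fstExt R V q - cPart R V q * ι R x.1 := by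
  refine (congrArg (fstExt R V) (CliffordAlgebra.contractRight_mul_ι _ x q)).trans ?_
  rw [map_sub, map_smul, map_mul]
  exact congrArg (_ - _ * ·) (fstExt_ι x)

theorem cPart_inlExt (q : ExteriorAlgebra R V) : cPart R V (inlExt R V q) = 0 := by
  induction q using exteriorAlgebra_right_induction with
  | algebraMap r => rw [AlgHom.commutes, cPart_algebraMap]
  | add a b ha hb => rw [map_add, map_add, ha, hb, add_zero]
  | mul_ι x q h => rw [map_mul, inlExt_ι, cPart_mul_ι, h, zero_smul, zero_mul, sub_zero]

theorem cPart_inlExt_mul_ι (q : ExteriorAlgebra R V) :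
    cPart R V (inlExt R V q * ι R ((0 : V), (1 : R))) = q := by
  rw [cPart_mul_ι, cPart_inlExt, fstExt_inlExt, one_smul, zero_mul, sub_zero]

theorem inlExt_fstExt_add_inlExt_cPart_mul_ι (q : ExteriorAlgebra R (V × R)) :
    inlExt R V (fstExt R V q) + inlExt R V (cPart R V q) * ι R ((0 : V), (1 : R)) = q := by
  induction q using exteriorAlgebra_right_induction with
  | algebraMap r => rw [cPart_algebraMap, AlgHom.commutes, AlgHom.commutes, map_zero, zero_mul,
      add_zero]
  | add a b ha hb =>
    nth_rewrite 3 [← ha]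
    nth_rewrite 3 [← hb]
    simp only [map_add, add_mul]
    abel
  | mul_ι x q h =>
    have hx : ι R x = ι R (x.1, (0 : R)) + x.2 • ι R ((0 : V), (1 : R)) := by
      rw [← map_smul, ← map_add]
      simp
    have hc : (ι R ((0 : V), (1 : R))) * ι R ((0 : V), (1 : R)) = 0 := ι_sq_zero _
    nth_rewrite 3 [← h]
    rw [cPart_mul_ι, map_mul, fstExt_ι, map_mul, inlExt_ι, map_sub, map_smul, map_mul, inlExt_ι, hx,
      sub_mul, mul_assoc _ (ι R (x.1, (0 : R))), ι_mul_ι_swap (x.1, (0 : R)), add_mul, mul_add,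
      mul_add, mul_smul_comm, mul_smul_comm, mul_assoc _ _ (ι R ((0 : V), (1 : R))), hc, mul_zero,
      smul_zero, smul_mul_assoc]
    noncomm_ring

theorem cPart_parity (q : ExteriorAlgebra R (V × R)) :
    cPart R V (parity R (V × R) q) = -parity R V (cPart R V q) := by
  conv_lhs => rw [← inlExt_fstExt_add_inlExt_cPart_mul_ι q]
  rw [map_add, map_mul, parity_ι, mul_neg, inlExt, parity_map, parity_map, ← inlExt, map_add,
    map_neg, cPart_inlExt, cPart_inlExt_mul_ι, zero_add]

theorem parity_cPart_coe {k : ℕ} (p : ⋀[R]^k (V × R)) :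
    parity R V (cPart R V (p : ExteriorAlgebra R (V × R))) =
      (-1 : R) ^ (k + 1) • cPart R V (p : ExteriorAlgebra R (V × R)) := by
  rw [← neg_neg (parity R V _), ← cPart_parity, parity_coe, map_smul, pow_succ', neg_one_mul,
    neg_smul]

end Prod

/-! ### Lie algebra homology -/

section Homology

open ExteriorAlgebra

variable {𝔤 𝔥 : Type*} [LieRing 𝔤] [LieAlgebra ℝ 𝔤] [LieRing 𝔥] [LieAlgebra ℝ 𝔥]

theorem boundaryExt_algebraMap (r : ℝ) :
    boundaryExt (algebraMap ℝ (ExteriorAlgebra ℝ 𝔤) r) = 0 := by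
  rw [Algebra.algebraMap_eq_smul_one, map_smul, boundaryExt_one, smul_zero]

theorem adExt_ι (y x : 𝔤) : adExt y (ι ℝ x) = ι ℝ ⁅y, x⁆ := by
  simpa [adExt_one] using adExt_ι_mul y x 1

theorem boundaryExt_ι (x : 𝔤) : boundaryExt (ι ℝ x) = 0 := by
  simpa [adExt_one, boundaryExt_one] using boundaryExt_ι_mul x 1

theorem adExt_mul_ι (y x : 𝔤) (q : ExteriorAlgebra ℝ 𝔤) :
    adExt y (q * ι ℝ x) = adExt y q * ι ℝ x + q * ι ℝ ⁅y, x⁆ := by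
  induction q using exteriorAlgebra_left_induction with
  | algebraMap r =>
    rw [adExt_algebraMap, zero_mul, zero_add, Algebra.algebraMap_eq_smul_one, smul_one_mul,
      map_smul, adExt_ι, smul_one_mul]
  | add a b ha hb => simp only [add_mul, map_add, ha, hb]; abel
  | ι_mul q z h => rw [mul_assoc, adExt_ι_mul, h, adExt_ι_mul]; noncomm_ring

theorem adExt_parity (y : 𝔤) (q : ExteriorAlgebra ℝ 𝔤) :
    adExt y (parity ℝ 𝔤 q) = parity ℝ 𝔤 (adExt y q) := by
  induction q using exteriorAlgebra_left_induction with
  | algebraMap r => rw [AlgHom.commutes, adExt_algebraMap, map_zero]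
  | add a b ha hb => simp only [map_add, ha, hb]
  | ι_mul q z h =>
    rw [map_mul, parity_ι, neg_mul, map_neg, adExt_ι_mul, h, adExt_ι_mul, map_add, map_mul,
      map_mul, parity_ι, parity_ι]
    noncomm_ring

theorem boundaryExt_mul_ι (x : 𝔤) (q : ExteriorAlgebra ℝ 𝔤) :
    boundaryExt (q * ι ℝ x) = boundaryExt q * ι ℝ x - adExt x (parity ℝ 𝔤 q) := by
  induction q using exteriorAlgebra_left_induction with
  | algebraMap r =>
    rw [AlgHom.commutes, adExt_algebraMap, boundaryExt_algebraMap, zero_mul, sub_zero,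
      Algebra.algebraMap_eq_smul_one, smul_one_mul, map_smul, boundaryExt_ι, smul_zero]
  | add a b ha hb => simp only [add_mul, map_add, ha, hb]; abel
  | ι_mul q z h =>
    rw [mul_assoc, boundaryExt_ι_mul, h, boundaryExt_ι_mul, adExt_mul_ι, map_mul, parity_ι,
      neg_mul, map_neg, adExt_ι_mul, mul_ι_eq_ι_mul_parity q ⁅z, x⁆, ← lie_skew x z, map_neg]
    noncomm_ring

theorem coe_boundary (k : ℕ) (p : ⋀[ℝ]^(k + 1) 𝔤) :
    (boundary k p : ExteriorAlgebra ℝ 𝔤) = boundaryExt (p : ExteriorAlgebra ℝ 𝔤) := by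
  have : (⋀[ℝ]^k 𝔤).subtype ∘ₗ boundary k = boundaryExt ∘ₗ (⋀[ℝ]^(k + 1) 𝔤).subtype := by
    apply exteriorPower.linearMap_ext
    ext x
    cases k with
    | zero => simp [boundary, ExteriorAlgebra.ιMulti_succ_apply, boundaryExt_ι]
    | succ k =>
      simp only [LinearMap.compAlternatingMap_apply, LinearMap.comp_apply, boundary,
        exteriorPower.alternatingMapLinearEquiv_apply_ιMulti, Submodule.subtype_apply,
        exteriorPower.ιMulti_apply_coe]
      exact coe_boundaryFun x
  exact LinearMap.congr_fun this p

theorem boundaryExt_eq_zero_of_mem_cycles {k : ℕ} {p : ⋀[ℝ]^k 𝔤} (hp : p ∈ cycles 𝔤 k) :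
    boundaryExt (p : ExteriorAlgebra ℝ 𝔤) = 0 := by
  cases k with
  | zero =>
    obtain ⟨r, hr⟩ := exists_algebraMap_eq_coe p
    rw [← hr, boundaryExt_algebraMap]
  | succ k =>
    rw [← coe_boundary, show boundary k p = 0 from hp]
    rfl

theorem adExt_map (φ : 𝔤 →ₗ⁅ℝ⁆ 𝔥) (y : 𝔤) (q : ExteriorAlgebra ℝ 𝔤) :
    adExt (φ y) (ExteriorAlgebra.map (φ : 𝔤 →ₗ[ℝ] 𝔥) q) =
      ExteriorAlgebra.map (φ : 𝔤 →ₗ[ℝ] 𝔥) (adExt y q) := by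
  induction q using exteriorAlgebra_left_induction with
  | algebraMap r => rw [AlgHom.commutes, adExt_algebraMap, adExt_algebraMap, map_zero]
  | add a b ha hb => simp only [map_add, ha, hb]
  | ι_mul q z h =>
    simp only [map_mul, map_apply_ι, adExt_ι_mul, h, map_add, LieHom.coe_toLinearMap,
      LieHom.map_lie]

theorem boundaryExt_map (φ : 𝔤 →ₗ⁅ℝ⁆ 𝔥) (q : ExteriorAlgebra ℝ 𝔤) :
    boundaryExt (ExteriorAlgebra.map (φ : 𝔤 →ₗ[ℝ] 𝔥) q) =
      ExteriorAlgebra.map (φ : 𝔤 →ₗ[ℝ] 𝔥) (boundaryExt q) := by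
  induction q using exteriorAlgebra_left_induction with
  | algebraMap r => rw [AlgHom.commutes, boundaryExt_algebraMap, boundaryExt_algebraMap, map_zero]
  | add a b ha hb => simp only [map_add, ha, hb]
  | ι_mul q z h =>
    simp only [map_mul, map_apply_ι, boundaryExt_ι_mul, h, map_sub, map_neg, ← adExt_map,
      LieHom.coe_toLinearMap]

theorem boundary_map (φ : 𝔤 →ₗ⁅ℝ⁆ 𝔥) (k : ℕ) (p : ⋀[ℝ]^(k + 1) 𝔤) :
    boundary k (exteriorPower.map (k + 1) (φ : 𝔤 →ₗ[ℝ] 𝔥) p) =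
      exteriorPower.map k (φ : 𝔤 →ₗ[ℝ] 𝔥) (boundary k p) := by
  apply Subtype.ext
  rw [coe_boundary, coe_exteriorPower_map, coe_exteriorPower_map, coe_boundary, boundaryExt_map]

theorem adExt_c (q : ExteriorAlgebra ℝ (𝔤 × ℝ)) : adExt ((0 : 𝔤), (1 : ℝ)) q = 0 := by
  induction q using exteriorAlgebra_left_induction with
  | algebraMap r => rw [adExt_algebraMap]
  | add a b ha hb => rw [map_add, ha, hb, add_zero]
  | ι_mul q z h =>
    have hz : ⁅((0 : 𝔤), (1 : ℝ)), z⁆ = 0 := Prod.ext (zero_lie z.1) rfl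
    rw [adExt_ι_mul, h, hz, map_zero, zero_mul, mul_zero, add_zero]

theorem boundaryExt_inlExt (q : ExteriorAlgebra ℝ 𝔤) :
    boundaryExt (inlExt ℝ 𝔤 q) = inlExt ℝ 𝔤 (boundaryExt q) :=
  boundaryExt_map (LieHom.inl ℝ 𝔤 ℝ) q

theorem cPart_boundaryExt (q : ExteriorAlgebra ℝ (𝔤 × ℝ)) :
    cPart ℝ 𝔤 (boundaryExt q) = boundaryExt (cPart ℝ 𝔤 q) := by
  conv_lhs => rw [← inlExt_fstExt_add_inlExt_cPart_mul_ι q]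
  rw [map_add, boundaryExt_mul_ι, adExt_c, sub_zero, boundaryExt_inlExt, boundaryExt_inlExt,
    map_add, cPart_inlExt, cPart_inlExt_mul_ι, zero_add]

theorem coe_tensorC {k : ℕ} (p : ⋀[ℝ]^k 𝔤) :
    (tensorC p : ExteriorAlgebra ℝ (𝔤 × ℝ)) =
      inlExt ℝ 𝔤 (p : ExteriorAlgebra ℝ 𝔤) * ι ℝ ((0 : 𝔤), (1 : ℝ)) :=
  congrArg (· * ι ℝ ((0 : 𝔤), (1 : ℝ))) (coe_exteriorPower_map k (LinearMap.inl ℝ 𝔤 ℝ) p)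

theorem exists_map_inl_add_tensorC_eq (k : ℕ) (P : ⋀[ℝ]^(k + 1) (𝔤 × ℝ)) :
    ∃ (p₀ : ⋀[ℝ]^(k + 1) 𝔤) (p₁ : ⋀[ℝ]^k 𝔤),
      exteriorPower.map (k + 1) (LinearMap.inl ℝ 𝔤 ℝ) p₀ + tensorC p₁ = P := by
  refine ⟨exteriorPower.map (k + 1) (LinearMap.fst ℝ 𝔤 ℝ) P,
    exteriorPower.map k (LinearMap.fst ℝ 𝔤 ℝ)
      ⟨_, contractRight_mem P.2 (LinearMap.snd ℝ 𝔤 ℝ)⟩, Subtype.ext ?_⟩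
  rw [Submodule.coe_add, coe_tensorC, coe_exteriorPower_map, coe_exteriorPower_map,
    coe_exteriorPower_map]
  exact inlExt_fstExt_add_inlExt_cPart_mul_ι _

end Homology

/-! ### Graded forms -/

section Graded

variable {E : Type*} [NormedAddCommGroup E] [NormedSpace ℝ E]
  {M : Type*} [TopologicalSpace M] [ChartedSpace E M]

variable (E M) in
/-- The graded space of smooth forms. Operators of any degree act on it as endomorphisms, which
avoids casts between the types of forms of equal degree. -/
def GradedForm : Type _ := ∀ j : ℕ, Form E M j

instance : AddCommGroup (GradedForm E M) :=
  inferInstanceAs (AddCommGroup (∀ j : ℕ, Form E M j))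

instance : Module ℝ (GradedForm E M) := inferInstanceAs (Module ℝ (∀ j : ℕ, Form E M j))

@[ext]
theorem GradedForm.ext {α β : GradedForm E M} (h : ∀ j, α j = β j) : α = β := funext h

/-- The component of degree `j` of a graded form. -/
def component (j : ℕ) : GradedForm E M →ₗ[ℝ] Form E M j :=
  LinearMap.proj (φ := fun j => Form E M j) j

variable (E M) in
/-- The inclusion of the forms of degree `N` into the graded forms. -/
def ofForm (N : ℕ) : Form E M N →ₗ[ℝ] GradedForm E M :=
  LinearMap.single ℝ (fun j => Form E M j) N

theorem ofForm_self {N : ℕ} (α : Form E M N) : ofForm E M N α N = α :=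
  Pi.single_eq_same (M := fun j => Form E M j) N α

theorem ofForm_of_ne {N j : ℕ} (h : j ≠ N) (α : Form E M N) : ofForm E M N α j = 0 :=
  Pi.single_eq_of_ne (M := fun j => Form E M j) h α

variable [IsManifold 𝓘(ℝ, E) ∞ M]

/-- The exterior derivative of smooth forms. -/
def extDForm {k : ℕ} : Form E M k →ₗ[ℝ] Form E M (k + 1) where
  toFun α := ⟨extD (α : RawForm E M k), extD_mem α.2⟩
  map_add' α β := Subtype.ext (extD_add α.2 β.2)
  map_smul' c α := Subtype.ext (extD_smul c α.2)

/-- The exterior derivative of graded forms. -/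
def gradedExtD : Module.End ℝ (GradedForm E M) where
  toFun β
    | 0 => 0
    | _ + 1 => extDForm (β _)
  map_add' α β := by
    ext1 j
    cases j with
    | zero => exact (add_zero _).symm
    | succ j => exact map_add extDForm _ _
  map_smul' c β := by
    ext1 j
    cases j with
    | zero => exact (smul_zero c).symm
    | succ j => exact map_smul extDForm _ _

theorem gradedExtD_gradedExtD (β : GradedForm E M) : gradedExtD (gradedExtD β) = 0 := by
  ext1 j
  match j with
  | 0 => rfl
  | 1 => exact map_zero extDForm
  | j + 2 => exact Subtype.ext (extD_extD (β j).2)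

theorem gradedExtD_ofForm {N : ℕ} (α : Form E M N) :
    gradedExtD (ofForm E M N α) = ofForm E M (N + 1) (extDForm α) := by
  ext1 j
  cases j with
  | zero => exact (ofForm_of_ne (by omega) _).symm
  | succ j =>
    change extDForm (ofForm E M N α j) = _
    obtain rfl | h := eq_or_ne j N
    · rw [ofForm_self, ofForm_self]
    · rw [ofForm_of_ne h, ofForm_of_ne (by omega), map_zero]

/-- The interior product of smooth forms. -/
def iotaForm {k : ℕ} (X : VField E M) : Form E M (k + 1) →ₗ[ℝ] Form E M k where
  toFun α := ⟨iota X (α : RawForm E M (k + 1)), iota_mem X α.2⟩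
  map_add' _ _ := rfl
  map_smul' _ _ := rfl

variable (E M) in
/-- The interior product of graded forms. -/
def gradedIota : VField E M →ₗ[ℝ] Module.End ℝ (GradedForm E M) where
  toFun X :=
    { toFun := fun β j => iotaForm X (β (j + 1))
      map_add' := fun _ _ => rfl
      map_smul' := fun _ _ => rfl }
  map_add' X Y := by
    ext β j a : 4
    exact map_add (formAt (β (j + 1)).1 a).curryLeft (fieldAt X a) (fieldAt Y a)
  map_smul' c X := by
    ext β j a : 4
    exact map_smul (formAt (β (j + 1)).1 a).curryLeft c (fieldAt X a)

theorem gradedIota_self_self (X : VField E M) (β : GradedForm E M) :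
    gradedIota E M X (gradedIota E M X β) = 0 := by
  ext j a : 3
  exact interior_interior_self (fieldAt X a) (formAt (β (j + 2)).1 a)

theorem gradedIota_swap (X Y : VField E M) (β : GradedForm E M) :
    gradedIota E M X (gradedIota E M Y β) = -gradedIota E M Y (gradedIota E M X β) := by
  have h := gradedIota_self_self (X + Y) β
  simp only [map_add, LinearMap.add_apply, gradedIota_self_self, zero_add, add_zero] at h
  exact eq_neg_of_add_eq_zero_right h

theorem gradedIota_ofForm {N : ℕ} (X : VField E M) (α : Form E M (N + 1)) :
    gradedIota E M X (ofForm E M (N + 1) α) = ofForm E M N (iotaForm X α) := by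
  ext1 j
  change iotaForm X (ofForm E M (N + 1) α (j + 1)) = _
  obtain rfl | h := eq_or_ne j N
  · rw [ofForm_self, ofForm_self]
  · rw [ofForm_of_ne h, ofForm_of_ne (by omega), map_zero]

variable (E M) in
/-- The Lie derivative of graded forms. -/
def gradedLieD : VField E M →ₗ[ℝ] Module.End ℝ (GradedForm E M) :=
  LinearMap.mulLeft ℝ gradedExtD ∘ₗ gradedIota E M +
    LinearMap.mulRight ℝ gradedExtD ∘ₗ gradedIota E M

theorem gradedLieD_apply (X : VField E M) (β : GradedForm E M) :
    gradedLieD E M X β = gradedExtD (gradedIota E M X β) + gradedIota E M X (gradedExtD β) := rfl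

theorem coe_gradedLieD (X : VField E M) (β : GradedForm E M) (j : ℕ) :
    (gradedLieD E M X β j : RawForm E M j) = lieD X (β j : RawForm E M j) := by
  cases j with
  | zero => exact zero_add _
  | succ j => rfl

theorem gradedLieD_gradedIota {X Y Z : VField E M}
    (h : ∀ a : M, Z a = VectorField.mlieBracket 𝓘(ℝ, E) X Y a) (β : GradedForm E M) :
    gradedLieD E M X (gradedIota E M Y β) =
      gradedIota E M Y (gradedLieD E M X β) + gradedIota E M Z β := by
  ext1 j
  apply Subtype.ext
  rw [coe_gradedLieD]
  refine (lieD_iota X Y (β (j + 1)).2).trans ?_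
  have hZ : iotaBracket X Y (β (j + 1) : RawForm E M (j + 1)) = iota Z (β (j + 1)).1 :=
    funext fun a => congrArg (interior · _) (h a).symm
  rw [← coe_gradedLieD, hZ]
  rfl

theorem gradedLieD_ofForm_eq_zero {N : ℕ} {X : VField E M} {α : Form E M N}
    (h : lieD X (α : RawForm E M N) = 0) : gradedLieD E M X (ofForm E M N α) = 0 := by
  ext1 j
  apply Subtype.ext
  rw [coe_gradedLieD]
  obtain rfl | hj := eq_or_ne j N
  · rw [ofForm_self, h]
    rfl
  · rw [ofForm_of_ne hj, ← show (0 : GradedForm E M) j = 0 from rfl, ← coe_gradedLieD, map_zero]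

end Graded

/-! ### Contraction with multivectors -/

section Contraction

open ExteriorAlgebra

variable {E : Type*} [NormedAddCommGroup E] [NormedSpace ℝ E]
  {M : Type*} [TopologicalSpace M] [ChartedSpace E M] [IsManifold 𝓘(ℝ, E) ∞ M]

section Linear

variable {V W : Type*} [AddCommGroup V] [Module ℝ V] [AddCommGroup W] [Module ℝ W]

theorem gradedIota_comp_self_self (v : V →ₗ[ℝ] VField E M) (x : V) (β : GradedForm E M) :
    (gradedIota E M ∘ₗ v) x ((gradedIota E M ∘ₗ v) x β) = (0 : QuadraticForm ℝ V) x • β :=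
  (gradedIota_self_self (v x) β).trans (zero_smul ℝ β).symm

/-- The contraction `q ↦ ι(v_q)` of graded forms, where `ι(v_{p ∧ q}) = ι(v_q) ι(v_p)`. -/
def contraction (v : V →ₗ[ℝ] VField E M) :
    ExteriorAlgebra ℝ V →ₗ[ℝ] Module.End ℝ (GradedForm E M) :=
  (CliffordAlgebra.foldl (0 : QuadraticForm ℝ V) (gradedIota E M ∘ₗ v)
    (gradedIota_comp_self_self v)).flip

variable (v : V →ₗ[ℝ] VField E M)

theorem contraction_mul (p q : ExteriorAlgebra ℝ V) (β : GradedForm E M) :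
    contraction v (p * q) β = contraction v q (contraction v p β) :=
  CliffordAlgebra.foldl_mul _ _ (gradedIota_comp_self_self v) β p q

theorem contraction_algebraMap (r : ℝ) (β : GradedForm E M) :
    contraction v (algebraMap ℝ _ r) β = r • β :=
  CliffordAlgebra.foldl_algebraMap _ _ (gradedIota_comp_self_self v) β r

theorem contraction_one (β : GradedForm E M) : contraction v 1 β = β :=
  CliffordAlgebra.foldl_one _ _ (gradedIota_comp_self_self v) β

theorem contraction_ι (x : V) (β : GradedForm E M) :
    contraction v (ι ℝ x) β = gradedIota E M (v x) β :=
  CliffordAlgebra.foldl_ι _ _ (gradedIota_comp_self_self v) β x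

theorem contraction_map (φ : W →ₗ[ℝ] V) (q : ExteriorAlgebra ℝ W) :
    contraction v (ExteriorAlgebra.map φ q) = contraction (v ∘ₗ φ) q := by
  ext1 β
  induction q using exteriorAlgebra_left_induction generalizing β with
  | algebraMap r => rw [AlgHom.commutes, contraction_algebraMap, contraction_algebraMap]
  | add a b ha hb => simp only [map_add, LinearMap.add_apply, ha, hb]
  | ι_mul q x h =>
    rw [map_mul, map_apply_ι, contraction_mul, contraction_mul, contraction_ι, contraction_ι, h,
      LinearMap.comp_apply]

theorem gradedIota_contraction (X : VField E M) (q : ExteriorAlgebra ℝ V) (β : GradedForm E M) :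
    gradedIota E M X (contraction v q β) =
      contraction v (parity ℝ V q) (gradedIota E M X β) := by
  induction q using exteriorAlgebra_left_induction generalizing β with
  | algebraMap r =>
    rw [AlgHom.commutes, contraction_algebraMap, contraction_algebraMap, map_smul]
  | add a b ha hb => simp only [map_add, LinearMap.add_apply, ha, hb]
  | ι_mul q x h =>
    rw [map_mul (parity ℝ V), parity_ι, contraction_mul, contraction_mul, contraction_ι, h,
      gradedIota_swap, map_neg, map_neg, LinearMap.neg_apply, contraction_ι, map_neg]

end Linear

section Action

variable {𝔤 : Type*} [LieRing 𝔤] [LieAlgebra ℝ 𝔤] {v : 𝔤 →ₗ[ℝ] VField E M}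

theorem gradedLieD_contraction
    (hv : ∀ (x y : 𝔤) (a : M), v ⁅x, y⁆ a = VectorField.mlieBracket 𝓘(ℝ, E) (v x) (v y) a)
    (x : 𝔤) (q : ExteriorAlgebra ℝ 𝔤) (β : GradedForm E M) :
    gradedLieD E M (v x) (contraction v q β) =
      contraction v q (gradedLieD E M (v x) β) + contraction v (adExt x q) β := by
  induction q using exteriorAlgebra_left_induction generalizing β with
  | algebraMap r =>
    rw [adExt_algebraMap, contraction_algebraMap, contraction_algebraMap, map_smul, map_zero,
      LinearMap.zero_apply, add_zero]
  | add a b ha hb => simp only [map_add, LinearMap.add_apply, ha, hb]; abel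
  | ι_mul q y h =>
    rw [contraction_mul, contraction_mul, contraction_ι, contraction_ι, h,
      gradedLieD_gradedIota (hv x y), adExt_ι_mul, map_add, map_add, LinearMap.add_apply,
      contraction_mul, contraction_mul, contraction_ι, contraction_ι, add_assoc]

theorem gradedExtD_contraction
    (hv : ∀ (x y : 𝔤) (a : M), v ⁅x, y⁆ a = VectorField.mlieBracket 𝓘(ℝ, E) (v x) (v y) a)
    {β : GradedForm E M} (hβ : ∀ x, gradedLieD E M (v x) β = 0) (q : ExteriorAlgebra ℝ 𝔤) :
    gradedExtD (contraction v q β) =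
      contraction v (parity ℝ 𝔤 q) (gradedExtD β) -
        contraction v (parity ℝ 𝔤 (boundaryExt q)) β := by
  induction q using exteriorAlgebra_right_induction with
  | algebraMap r =>
    rw [boundaryExt_algebraMap, AlgHom.commutes, contraction_algebraMap, contraction_algebraMap,
      map_smul, map_zero, map_zero, LinearMap.zero_apply, sub_zero]
  | add a b ha hb => simp only [map_add, LinearMap.add_apply, ha, hb]; abel
  | mul_ι x q h =>
    have cartan : gradedExtD (gradedIota E M (v x) (contraction v q β)) =
        gradedLieD E M (v x) (contraction v q β) -
          gradedIota E M (v x) (gradedExtD (contraction v q β)) := by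
      rw [gradedLieD_apply, add_sub_cancel_right]
    rw [contraction_mul, contraction_ι, cartan, gradedLieD_contraction hv, hβ, map_zero, zero_add,
      h, boundaryExt_mul_ι]
    simp only [map_mul, map_sub, map_neg, adExt_parity, parity_parity, parity_ι, mul_neg,
      LinearMap.neg_apply, LinearMap.sub_apply, contraction_mul, contraction_ι]
    abel

end Action

section Value

theorem contractVectors_zero {V : Type*} [AddCommGroup V] [Module ℝ V] [TopologicalSpace V]
    {N : ℕ} (h : 0 + N = N) (a : V [⋀^Fin N]→L[ℝ] ℝ) (X : Fin 0 → V) :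
    contractVectors h a X = a := by
  ext w
  refine congrArg a (funext fun l => ?_)
  rw [show Fin.cast h.symm l = Fin.natAdd 0 l from Fin.ext (zero_add _).symm, Fin.append_right]

theorem contractVectors_succ {V : Type*} [AddCommGroup V] [Module ℝ V] [TopologicalSpace V]
    {k j N : ℕ} (h : k + 1 + j = N + 1) (h' : k + j = N) (a : V [⋀^Fin (N + 1)]→L[ℝ] ℝ)
    (X : Fin (k + 1) → V) :
    contractVectors h a X = contractVectors h' (interior (X 0) a) (Fin.tail X) := by
  subst h'
  ext w
  refine congrArg a (funext fun i => ?_)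
  refine Fin.cases rfl (Fin.addCases (fun i => ?_) (fun i => ?_)) i
  · rw [show Fin.cast h.symm (Fin.castAdd j i).succ = Fin.castAdd j i.succ from Fin.ext rfl,
      Fin.append_left]
    exact (Fin.append_left (Fin.tail X) w i).symm
  · rw [show Fin.cast h.symm (Fin.natAdd k i).succ = Fin.natAdd (k + 1) i from
      Fin.ext (Nat.add_right_comm k i 1), Fin.append_right]
    exact (Fin.append_right (Fin.tail X) w i).symm

theorem contraction_ιMulti_apply {V : Type*} [AddCommGroup V] [Module ℝ V]
    (v : V →ₗ[ℝ] VField E M) {i j N : ℕ} (h : i + j = N) (x : Fin i → V) (α : Form E M N) (a : M) :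
    (contraction v (ExteriorAlgebra.ιMulti ℝ i x) (ofForm E M N α) j : RawForm E M j) a =
      contractVectors h ((α : RawForm E M N) a) fun l => v (x l) a := by
  induction i generalizing N with
  | zero =>
    obtain rfl : j = N := by omega
    rw [ExteriorAlgebra.ιMulti_zero_apply, contraction_one, ofForm_self, contractVectors_zero]
  | succ i ih =>
    obtain rfl : i + j + 1 = N := by omega
    rw [ExteriorAlgebra.ιMulti_succ_apply, contraction_mul, contraction_ι, gradedIota_ofForm,
      ih rfl, contractVectors_succ h rfl]
    rfl

theorem component_contraction_ofForm {𝔤 : Type*} [LieRing 𝔤] [LieAlgebra ℝ 𝔤]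
    (v : 𝔤 →ₗ[ℝ] VField E M) {i j N : ℕ} (h : i + j = N) (p : ⋀[ℝ]^i 𝔤) (α : Form E M N) :
    (component j (contraction v (p : ExteriorAlgebra ℝ 𝔤) (ofForm E M N α)) : RawForm E M j) =
      iotaP h v p (α : RawForm E M N) := by
  funext a
  let A : ⋀[ℝ]^i 𝔤 →ₗ[ℝ] (TangentSpace 𝓘(ℝ, E) a) [⋀^Fin j]→L[ℝ] ℝ :=
    LinearMap.proj a ∘ₗ (Form E M j).subtype ∘ₗ component j ∘ₗ
      LinearMap.applyₗ (ofForm E M N α) ∘ₗ contraction v ∘ₗ (⋀[ℝ]^i 𝔤).subtype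
  let B : ⋀[ℝ]^i 𝔤 →ₗ[ℝ] (TangentSpace 𝓘(ℝ, E) a) [⋀^Fin j]→L[ℝ] ℝ :=
    exteriorPower.alternatingMapLinearEquiv (contractAlt h ((α : RawForm E M N) a)) ∘ₗ
      exteriorPower.map i (evalAt E a ∘ₗ v)
  have : A = B := by
    apply exteriorPower.linearMap_ext
    ext x : 1
    simp only [LinearMap.compAlternatingMap_apply, B, LinearMap.comp_apply,
      exteriorPower.map_apply_ιMulti, exteriorPower.alternatingMapLinearEquiv_apply_ιMulti]
    exact contraction_ιMulti_apply v h x α a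
  exact LinearMap.congr_fun this p

end Value

end Contraction

/-! ### The extended action -/

section ExtendAction

open ExteriorAlgebra

variable {E : Type*} [NormedAddCommGroup E] [NormedSpace ℝ E]
  {M : Type*} [TopologicalSpace M] [ChartedSpace E M] [IsManifold 𝓘(ℝ, E) ∞ M]

theorem gradedLieD_gradedExtD (X : VField E M) (β : GradedForm E M) :
    gradedLieD E M X (gradedExtD β) = gradedExtD (gradedLieD E M X β) := by
  simp only [gradedLieD_apply, map_add, gradedExtD_gradedExtD, map_zero, add_zero, zero_add]

theorem gradedLieD_gradedIota_swap {X Y : VField E M} {β : GradedForm E M}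
    (hX : gradedExtD (gradedIota E M X β) = 0) (hY : gradedExtD (gradedIota E M Y β) = 0) :
    gradedLieD E M X (gradedIota E M Y β) = -gradedLieD E M Y (gradedIota E M X β) := by
  rw [gradedLieD_apply, gradedLieD_apply, hX, hY, map_zero, map_zero, add_zero, add_zero,
    gradedIota_swap, map_neg]

theorem eq_mlieBracket_of_gradedLieD_gradedIota {n : ℕ} {Ω : Form E M (n + 1)}
    (hΩ : IsPlectic Ω) {X Y Z : VField E M} (hX : lieD X (Ω : RawForm E M (n + 1)) = 0)
    (h : gradedLieD E M X (gradedIota E M Y (ofForm E M (n + 1) Ω)) =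
      gradedIota E M Z (ofForm E M (n + 1) Ω)) (a : M) :
    Z a = VectorField.mlieBracket 𝓘(ℝ, E) X Y a := by
  have hlie : lieD X (iota Y (Ω : RawForm E M (n + 1))) = iota Z Ω.1 := by
    have := coe_gradedLieD X (gradedIota E M Y (ofForm E M (n + 1) Ω)) n
    rw [h, gradedIota_ofForm, gradedIota_ofForm, ofForm_self, ofForm_self] at this
    exact this.symm
  rw [lieD_iota X Y Ω.2, hX] at hlie
  exact (hΩ.nondegenerate a ((zero_add _).symm.trans (congrFun hlie a))).symm

variable {m : ℕ} {Ω : Form E M (m + 2)} {H : Form E M m} {vH : VField E M}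

theorem gradedIota_hamiltonian (hH : IsHamiltonianVF Ω H vH) :
    gradedIota E M vH (ofForm E M (m + 2) Ω) = -gradedExtD (ofForm E M m H) := by
  rw [gradedExtD_ofForm, gradedIota_ofForm, ← map_neg]
  exact congrArg _ (Subtype.ext (neg_eq_iff_eq_neg.mpr hH).symm)

theorem gradedExtD_ofForm_eq_zero {N : ℕ} {α : Form E M N} (h : extD (α : RawForm E M N) = 0) :
    gradedExtD (ofForm E M N α) = 0 := by
  rw [gradedExtD_ofForm, show extDForm α = 0 from Subtype.ext h, map_zero]

theorem gradedExtD_gradedIota_hamiltonian (hH : IsHamiltonianVF Ω H vH) :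
    gradedExtD (gradedIota E M vH (ofForm E M (m + 2) Ω)) = 0 := by
  rw [gradedIota_hamiltonian hH, map_neg, gradedExtD_gradedExtD, neg_zero]

variable {𝔤 : Type*} [LieRing 𝔤] [LieAlgebra ℝ 𝔤] {v : 𝔤 →ₗ[ℝ] VField E M}

theorem extendAction_apply (v : 𝔤 →ₗ[ℝ] VField E M) (X : VField E M) (x : 𝔤 × ℝ) :
    extendAction v X x = v x.1 + x.2 • X := rfl

theorem extendAction_comp_inl (v : 𝔤 →ₗ[ℝ] VField E M) (X : VField E M) :
    extendAction v X ∘ₗ LinearMap.inl ℝ 𝔤 ℝ = v :=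
  LinearMap.coprod_inl _ _

theorem gradedLieD_extendAction (hΩ : IsPlectic Ω) (hv : IsMultisymplecticAction Ω v)
    (hH : IsHamiltonianVF Ω H vH) (x : 𝔤 × ℝ) :
    gradedLieD E M (extendAction v vH x) (ofForm E M (m + 2) Ω) = 0 := by
  have h : gradedLieD E M vH (ofForm E M (m + 2) Ω) = 0 := by
    rw [gradedLieD_apply, gradedExtD_gradedIota_hamiltonian hH,
      gradedExtD_ofForm_eq_zero hΩ.closed, map_zero, add_zero]
  rw [extendAction_apply, map_add, map_smul, LinearMap.add_apply, LinearMap.smul_apply, h,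
    gradedLieD_ofForm_eq_zero (hv.preserves x.1), smul_zero, add_zero]

theorem gradedLieD_gradedIota_extendAction (hΩ : IsPlectic Ω) (hv : IsMultisymplecticAction Ω v)
    (hH : IsHamiltonianVF Ω H vH) (hpres : StrictlyPreserves v H) (x y : 𝔤 × ℝ) :
    gradedLieD E M (extendAction v vH x)
        (gradedIota E M (extendAction v vH y) (ofForm E M (m + 2) Ω)) =
      gradedIota E M (extendAction v vH ⁅x, y⁆) (ofForm E M (m + 2) Ω) := by
  have closed (z : 𝔤) : gradedExtD (gradedIota E M (v z) (ofForm E M (m + 2) Ω)) = 0 := by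
    have h := gradedLieD_ofForm_eq_zero (hv.preserves z)
    rwa [gradedLieD_apply, gradedExtD_ofForm_eq_zero hΩ.closed, map_zero, add_zero] at h
  have action_hamiltonian (z : 𝔤) :
      gradedLieD E M (v z) (gradedIota E M vH (ofForm E M (m + 2) Ω)) = 0 := by
    rw [gradedIota_hamiltonian hH, map_neg, gradedLieD_gradedExtD,
      gradedLieD_ofForm_eq_zero (hpres z), map_zero, neg_zero]
  have hamiltonian_action (z : 𝔤) :
      gradedLieD E M vH (gradedIota E M (v z) (ofForm E M (m + 2) Ω)) = 0 := by
    rw [gradedLieD_gradedIota_swap (gradedExtD_gradedIota_hamiltonian hH) (closed z),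
      action_hamiltonian, neg_zero]
  have hamiltonian_hamiltonian :
      gradedLieD E M vH (gradedIota E M vH (ofForm E M (m + 2) Ω)) = 0 := by
    rw [gradedLieD_apply, gradedIota_self_self, gradedExtD_gradedIota_hamiltonian hH, map_zero,
      map_zero, add_zero]
  have action_action : gradedLieD E M (v x.1) (gradedIota E M (v y.1) (ofForm E M (m + 2) Ω)) =
      gradedIota E M (v ⁅x.1, y.1⁆) (ofForm E M (m + 2) Ω) := by
    rw [gradedLieD_gradedIota (hv.map_lie x.1 y.1), gradedLieD_ofForm_eq_zero (hv.preserves x.1),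
      map_zero, zero_add]
  have bracket : extendAction v vH ⁅x, y⁆ = v ⁅x.1, y.1⁆ := by
    rw [extendAction_apply, show ⁅x, y⁆ = (⁅x.1, y.1⁆, (0 : ℝ)) from rfl, zero_smul, add_zero]
  rw [bracket, ← action_action]
  simp only [extendAction_apply, map_add, map_smul, LinearMap.add_apply, LinearMap.smul_apply,
    action_hamiltonian, hamiltonian_action, hamiltonian_hamiltonian, smul_zero, add_zero]

theorem isMultisymplecticAction_extendAction (hΩ : IsPlectic Ω)
    (hv : IsMultisymplecticAction Ω v) (hH : IsHamiltonianVF Ω H vH)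
    (hpres : StrictlyPreserves v H) :
    IsMultisymplecticAction (𝔤 := 𝔤 × ℝ) Ω (extendAction v vH) := by
  have preserves (x : 𝔤 × ℝ) : lieD (extendAction v vH x) (Ω : RawForm E M (m + 2)) = 0 := by
    have h := coe_gradedLieD (extendAction v vH x) (ofForm E M (m + 2) Ω) (m + 2)
    rw [gradedLieD_extendAction hΩ hv hH, ofForm_self] at h
    exact h.symm
  exact ⟨fun x y => eq_mlieBracket_of_gradedLieD_gradedIota hΩ (preserves x)
    (gradedLieD_gradedIota_extendAction hΩ hv hH hpres x y), preserves⟩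

theorem contraction_extendAction (v : 𝔤 →ₗ[ℝ] VField E M) (X : VField E M)
    (q : ExteriorAlgebra ℝ (𝔤 × ℝ)) (β : GradedForm E M) :
    contraction (extendAction v X) q β =
      contraction v (fstExt ℝ 𝔤 q) β +
        contraction v (parity ℝ 𝔤 (cPart ℝ 𝔤 q)) (gradedIota E M X β) := by
  conv_lhs => rw [← inlExt_fstExt_add_inlExt_cPart_mul_ι q]
  rw [map_add, LinearMap.add_apply, contraction_mul, contraction_ι, inlExt, contraction_map,
    contraction_map, extendAction_comp_inl, extendAction_apply, map_zero, zero_add, one_smul,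
    gradedIota_contraction]

theorem contraction_extendAction_hamiltonian
    (hv : ∀ (x y : 𝔤) (a : M), v ⁅x, y⁆ a = VectorField.mlieBracket 𝓘(ℝ, E) (v x) (v y) a)
    (hH : IsHamiltonianVF Ω H vH) (hpres : StrictlyPreserves v H)
    (q : ExteriorAlgebra ℝ (𝔤 × ℝ)) :
    contraction (extendAction v vH) q (ofForm E M (m + 2) Ω) =
      contraction v (fstExt ℝ 𝔤 q) (ofForm E M (m + 2) Ω) -
        gradedExtD (contraction v (cPart ℝ 𝔤 q) (ofForm E M m H)) -
        contraction v (parity ℝ 𝔤 (cPart ℝ 𝔤 (boundaryExt q))) (ofForm E M m H) := by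
  rw [contraction_extendAction,
    gradedExtD_contraction hv (fun x => gradedLieD_ofForm_eq_zero (hpres x)),
    gradedIota_hamiltonian hH, cPart_boundaryExt, map_neg]
  abel

end ExtendAction

/-! ### The extended co-momentum map -/

section ExtendCoMomentum

open ExteriorAlgebra

variable {E : Type*} [NormedAddCommGroup E] [NormedSpace ℝ E]
  {M : Type*} [TopologicalSpace M] [ChartedSpace E M] [IsManifold 𝓘(ℝ, E) ∞ M]
  {𝔤 : Type*} [LieRing 𝔤] [LieAlgebra ℝ 𝔤]
  {m : ℕ} {Ω : Form E M (m + 2)} {v : 𝔤 →ₗ[ℝ] VField E M} {H : Form E M m} {vH : VField E M}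

theorem sgn_one : sgn 1 = 1 := by simp [sgn]

theorem sgn_succ (k : ℕ) : sgn (k + 1) = (-1) ^ (k + 1) * sgn k := by
  have h : (k + 1) * (k + 1 + 1) / 2 = k * (k + 1) / 2 + (k + 1) := by
    rw [show (k + 1) * (k + 1 + 1) = k * (k + 1) + (k + 1) * 2 by ring,
      Nat.add_mul_div_right _ _ two_pos]
  rw [sgn, sgn, h, pow_add]
  ring

theorem sgn_succ_mul_neg_one_pow (k : ℕ) : sgn (k + 1) * (-1) ^ (k + 1) = sgn k := by
  rw [sgn_succ, mul_right_comm, ← mul_pow, neg_one_mul, neg_neg, one_pow, one_mul]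

theorem sgn_smul_contraction_extendAction
    (hv : ∀ (x y : 𝔤) (a : M), v ⁅x, y⁆ a = VectorField.mlieBracket 𝓘(ℝ, E) (v x) (v y) a)
    (hH : IsHamiltonianVF Ω H vH) (hpres : StrictlyPreserves v H) {i : ℕ}
    (P : ⋀[ℝ]^(i + 1) (𝔤 × ℝ)) :
    sgn (i + 1) • contraction (extendAction v vH) (P : ExteriorAlgebra ℝ (𝔤 × ℝ))
        (ofForm E M (m + 2) Ω) =
      sgn (i + 1) • contraction v
        (exteriorPower.map (i + 1) (LinearMap.fst ℝ 𝔤 ℝ) P : ⋀[ℝ]^(i + 1) 𝔤)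
        (ofForm E M (m + 2) Ω) -
      gradedExtD (sgn (i + 1) • contraction v (cPart ℝ 𝔤 (P : ExteriorAlgebra ℝ (𝔤 × ℝ)))
        (ofForm E M m H)) -
      sgn i • contraction v (cPart ℝ 𝔤 (boundary i P : ExteriorAlgebra ℝ (𝔤 × ℝ)))
        (ofForm E M m H) := by
  rw [contraction_extendAction_hamiltonian hv hH hpres, ← coe_boundary, parity_cPart_coe,
    map_smul, LinearMap.smul_apply, coe_exteriorPower_map, ← fstExt, smul_sub, smul_sub,
    smul_smul, sgn_succ_mul_neg_one_pow, map_smul]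

theorem component_gradedExtD (j : ℕ) (β : GradedForm E M) :
    component (j + 1) (gradedExtD β) = extDForm (component j β) := rfl

theorem component_zero_gradedExtD (β : GradedForm E M) : component 0 (gradedExtD β) = 0 := rfl

/-- The part of the extended co-momentum map that depends on `H`: it vanishes on `Λ 𝔤`, and its
value at `p ⊗ c` is `ς(i) ι(v_p) H`. -/
def hamiltonianPart (v : 𝔤 →ₗ[ℝ] VField E M) (H : Form E M m) (i j : ℕ) :
    ⋀[ℝ]^i (𝔤 × ℝ) →ₗ[ℝ] Form E M j :=
  sgn i • (component j ∘ₗ LinearMap.applyₗ (ofForm E M m H) ∘ₗ contraction v ∘ₗ cPart ℝ 𝔤 ∘ₗ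
    (⋀[ℝ]^i (𝔤 × ℝ)).subtype)

theorem hamiltonianPart_apply {i j : ℕ} (P : ⋀[ℝ]^i (𝔤 × ℝ)) :
    hamiltonianPart v H i j P = component j (sgn i • contraction v
      (cPart ℝ 𝔤 (P : ExteriorAlgebra ℝ (𝔤 × ℝ))) (ofForm E M m H)) := rfl

theorem hamiltonianPart_zero (j : ℕ) : hamiltonianPart v H 0 j = 0 := by
  ext1 P
  obtain ⟨r, hr⟩ := exists_algebraMap_eq_coe P
  rw [hamiltonianPart_apply, ← hr, cPart_algebraMap, map_zero, LinearMap.zero_apply, smul_zero,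
    map_zero, LinearMap.zero_apply]

theorem hamiltonianPart_map_inl {i j : ℕ} (p : ⋀[ℝ]^i 𝔤) :
    hamiltonianPart v H i j (exteriorPower.map i (LinearMap.inl ℝ 𝔤 ℝ) p) = 0 := by
  rw [hamiltonianPart_apply, coe_exteriorPower_map, ← inlExt, cPart_inlExt, map_zero,
    LinearMap.zero_apply, smul_zero, map_zero]

theorem hamiltonianPart_tensorC {i j : ℕ} (p : ⋀[ℝ]^i 𝔤) :
    hamiltonianPart v H (i + 1) j (tensorC p) = component j (sgn (i + 1) • contraction v
      (p : ExteriorAlgebra ℝ 𝔤) (ofForm E M m H)) := by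
  rw [hamiltonianPart_apply, coe_tensorC, cPart_inlExt_mul_ι]

/-- The maps of the extended co-momentum map. -/
def extendF (f : CoMomentum Ω v) (H : Form E M m) (i j : ℕ) (h : i + j = m + 1) :
    ⋀[ℝ]^i (𝔤 × ℝ) →ₗ[ℝ] Form E M j :=
  f.f i j h ∘ₗ exteriorPower.map i (LinearMap.fst ℝ 𝔤 ℝ) + hamiltonianPart v H i j

variable (f : CoMomentum Ω v)

theorem extendF_apply {i j : ℕ} (h : i + j = m + 1) (P : ⋀[ℝ]^i (𝔤 × ℝ)) :
    extendF f H i j h P = f.f i j h (exteriorPower.map i (LinearMap.fst ℝ 𝔤 ℝ) P) +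
      hamiltonianPart v H i j P := rfl

theorem extendF_map_inl {i j : ℕ} (h : i + j = m + 1) (p : ⋀[ℝ]^i 𝔤) :
    extendF f H i j h (exteriorPower.map i (LinearMap.inl ℝ 𝔤 ℝ) p) = f.f i j h p := by
  have fst_inl : exteriorPower.map i (LinearMap.fst ℝ 𝔤 ℝ)
      (exteriorPower.map i (LinearMap.inl ℝ 𝔤 ℝ) p) = p := by
    rw [← LinearMap.comp_apply, ← exteriorPower.map_comp, LinearMap.fst_comp_inl,
      exteriorPower.map_id, LinearMap.id_apply]
  rw [extendF_apply, fst_inl, hamiltonianPart_map_inl, add_zero]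

theorem extendF_tensorC {i j : ℕ} (h : i + 1 + j = m + 1) (p : ⋀[ℝ]^i 𝔤) :
    extendF f H (i + 1) j h (tensorC p) = component j (sgn (i + 1) • contraction v
      (p : ExteriorAlgebra ℝ 𝔤) (ofForm E M m H)) := by
  have fst_tensorC : exteriorPower.map (i + 1) (LinearMap.fst ℝ 𝔤 ℝ) (tensorC p) = 0 := by
    apply Subtype.ext
    rw [coe_exteriorPower_map, coe_tensorC, map_mul, map_apply_ι, LinearMap.fst_apply, map_zero,
      mul_zero, ZeroMemClass.coe_zero]
  rw [extendF_apply, fst_tensorC, map_zero, zero_add, hamiltonianPart_tensorC]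

theorem extendF_zero : extendF f H 0 (m + 1) (Nat.zero_add _) = 0 := by
  rw [extendF, f.f_zero, hamiltonianPart_zero, LinearMap.zero_comp, add_zero]

theorem extendF_boundary {i j : ℕ} (h : i + j = m + 1) (P : ⋀[ℝ]^(i + 1) (𝔤 × ℝ)) :
    extendF f H i j h (boundary i P) =
      f.f i j h (boundary i (exteriorPower.map (i + 1) (LinearMap.fst ℝ 𝔤 ℝ) P)) +
        hamiltonianPart v H i j (boundary i P) :=
  congrArg (f.f i j h · + _) (boundary_map (LieHom.fst ℝ 𝔤 ℝ) i P).symm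

theorem CoMomentum.neg_f_boundary (i j : ℕ) (h : i + (j + 1) = m + 1) (p : ⋀[ℝ]^(i + 1) 𝔤) :
    -f.f i (j + 1) h (boundary i p) =
      extDForm (f.f (i + 1) j (by omega) p) + sgn (i + 1) •
        component (j + 1) (contraction v (p : ExteriorAlgebra ℝ 𝔤) (ofForm E M (m + 2) Ω)) := by
  have main := f.main i j h p
  rw [← component_contraction_ofForm] at main
  exact Subtype.ext main

theorem CoMomentum.neg_f_boundary_top (p : ⋀[ℝ]^(m + 2) 𝔤) :
    -f.f (m + 1) 0 rfl (boundary (m + 1) p) = sgn (m + 2) •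
      component 0 (contraction v (p : ExteriorAlgebra ℝ 𝔤) (ofForm E M (m + 2) Ω)) := by
  have main := f.main_top p
  rw [← component_contraction_ofForm] at main
  exact Subtype.ext main

theorem neg_extendF_boundary
    (hv : ∀ (x y : 𝔤) (a : M), v ⁅x, y⁆ a = VectorField.mlieBracket 𝓘(ℝ, E) (v x) (v y) a)
    (hH : IsHamiltonianVF Ω H vH) (hpres : StrictlyPreserves v H)
    (i j : ℕ) (h : i + (j + 1) = m + 1) (P : ⋀[ℝ]^(i + 1) (𝔤 × ℝ)) :
    -extendF f H i (j + 1) h (boundary i P) =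
      extDForm (extendF f H (i + 1) j (by omega) P) + sgn (i + 1) • component (j + 1)
        (contraction (extendAction v vH) (P : ExteriorAlgebra ℝ (𝔤 × ℝ))
          (ofForm E M (m + 2) Ω)) := by
  have main := f.neg_f_boundary i j h (exteriorPower.map (i + 1) (LinearMap.fst ℝ 𝔤 ℝ) P)
  rw [← map_smul, sgn_smul_contraction_extendAction hv hH hpres, map_sub, map_sub, map_smul,
    component_gradedExtD, ← hamiltonianPart_apply, ← hamiltonianPart_apply, extendF_boundary,
    extendF_apply, map_add]
  linear_combination (norm := module) main

theorem neg_extendF_boundary_top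
    (hv : ∀ (x y : 𝔤) (a : M), v ⁅x, y⁆ a = VectorField.mlieBracket 𝓘(ℝ, E) (v x) (v y) a)
    (hH : IsHamiltonianVF Ω H vH) (hpres : StrictlyPreserves v H) (P : ⋀[ℝ]^(m + 2) (𝔤 × ℝ)) :
    -extendF f H (m + 1) 0 rfl (boundary (m + 1) P) = sgn (m + 2) • component 0
      (contraction (extendAction v vH) (P : ExteriorAlgebra ℝ (𝔤 × ℝ))
        (ofForm E M (m + 2) Ω)) := by
  have main := f.neg_f_boundary_top (exteriorPower.map (m + 2) (LinearMap.fst ℝ 𝔤 ℝ) P)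
  rw [← map_smul, sgn_smul_contraction_extendAction hv hH hpres, map_sub, map_sub, map_smul,
    component_zero_gradedExtD, ← hamiltonianPart_apply, extendF_boundary]
  linear_combination (norm := module) main

theorem extendF_main
    (hv : ∀ (x y : 𝔤) (a : M), v ⁅x, y⁆ a = VectorField.mlieBracket 𝓘(ℝ, E) (v x) (v y) a)
    (hH : IsHamiltonianVF Ω H vH) (hpres : StrictlyPreserves v H)
    (i j : ℕ) (h : i + (j + 1) = m + 1) (P : ⋀[ℝ]^(i + 1) (𝔤 × ℝ)) :
    -(extendF f H i (j + 1) h (boundary i P) : RawForm E M (j + 1)) =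
      extD (extendF f H (i + 1) j (by omega) P : RawForm E M j)
        + sgn (i + 1) • iotaP (by omega) (extendAction v vH) P (Ω : RawForm E M (m + 2)) := by
  rw [← component_contraction_ofForm]
  exact congrArg Subtype.val (neg_extendF_boundary f hv hH hpres i j h P)

theorem extendF_main_top
    (hv : ∀ (x y : 𝔤) (a : M), v ⁅x, y⁆ a = VectorField.mlieBracket 𝓘(ℝ, E) (v x) (v y) a)
    (hH : IsHamiltonianVF Ω H vH) (hpres : StrictlyPreserves v H) (P : ⋀[ℝ]^(m + 2) (𝔤 × ℝ)) :
    -(extendF f H (m + 1) 0 rfl (boundary (m + 1) P) : RawForm E M 0) =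
      sgn (m + 2) • iotaP rfl (extendAction v vH) P (Ω : RawForm E M (m + 2)) := by
  rw [← component_contraction_ofForm]
  exact congrArg Subtype.val (neg_extendF_boundary_top f hv hH hpres P)

theorem extendF_momentum
    (hv : ∀ (x y : 𝔤) (a : M), v ⁅x, y⁆ a = VectorField.mlieBracket 𝓘(ℝ, E) (v x) (v y) a)
    (hH : IsHamiltonianVF Ω H vH) (hpres : StrictlyPreserves v H) (x : 𝔤 × ℝ) :
    IsHamiltonianVF Ω (extendF f H 1 m (Nat.add_comm 1 m) (exteriorPower.ιMulti ℝ 1 ![x]))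
      (extendAction v vH x) := by
  have main := extendF_main f hv hH hpres 0 m (Nat.zero_add _) (exteriorPower.ιMulti ℝ 1 ![x])
  have iotaP_eq : iotaP (Nat.add_comm 1 (m + 1)) (extendAction v vH)
      (exteriorPower.ιMulti ℝ 1 ![x]) (Ω : RawForm E M (m + 2)) =
        iota (extendAction v vH x) (Ω : RawForm E M (m + 2)) := by
    rw [← component_contraction_ofForm, exteriorPower.ιMulti_apply_coe,
      ExteriorAlgebra.ιMulti_succ_apply, ExteriorAlgebra.ιMulti_zero_apply, mul_one,
      contraction_ι, gradedIota_ofForm]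
    exact congrArg Subtype.val (ofForm_self _)
  rw [extendF_zero, iotaP_eq, sgn_one] at main
  exact eq_neg_of_add_eq_zero_left
    ((congrArg (_ + ·) (one_smul ℝ _)).symm.trans (main.symm.trans neg_zero))

theorem exists_ιMulti_one_eq {R V : Type*} [CommRing R] [AddCommGroup V] [Module R V]
    (p : ⋀[R]^1 V) : ∃ x : V, exteriorPower.ιMulti R 1 ![x] = p :=
  ⟨exteriorPower.oneEquiv R V p, (exteriorPower.oneEquiv R V).injective
    (by rw [exteriorPower.oneEquiv_ιMulti]; rfl)⟩

/-- The extension of a co-momentum map by a preserved Hamiltonian form. -/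
def extendCoMomentum
    (hv : ∀ (x y : 𝔤) (a : M), v ⁅x, y⁆ a = VectorField.mlieBracket 𝓘(ℝ, E) (v x) (v y) a)
    (hH : IsHamiltonianVF Ω H vH) (hpres : StrictlyPreserves v H) :
    CoMomentum (𝔤 := 𝔤 × ℝ) Ω (extendAction v vH) where
  f := extendF f H
  f_zero := extendF_zero f
  hamiltonian p := by
    obtain ⟨x, rfl⟩ := exists_ιMulti_one_eq p
    exact ⟨_, extendF_momentum f hv hH hpres x⟩
  momentum := extendF_momentum f hv hH hpres
  main := extendF_main f hv hH hpres
  main_top := extendF_main_top f hv hH hpres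

theorem isExtension_extendCoMomentum
    (hv : ∀ (x y : 𝔤) (a : M), v ⁅x, y⁆ a = VectorField.mlieBracket 𝓘(ℝ, E) (v x) (v y) a)
    (hH : IsHamiltonianVF Ω H vH) (hpres : StrictlyPreserves v H) :
    IsExtension f H (extendCoMomentum f hv hH hpres) where
  restrict _ _ h p := extendF_map_inl f h p
  apply_tensorC i j h p := by
    rw [← component_contraction_ofForm v h]
    exact congrArg Subtype.val ((extendF_tensorC f (by omega) p).trans (map_smul _ _ _))

theorem IsExtension.unique {f : CoMomentum Ω v}
    {F F' : CoMomentum (𝔤 := 𝔤 × ℝ) Ω (extendAction v vH)}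
    (hF : IsExtension f H F) (hF' : IsExtension f H F') : F' = F := by
  ext1
  funext i j h
  cases i with
  | zero =>
    obtain rfl : j = m + 1 := by omega
    exact F'.f_zero.trans F.f_zero.symm
  | succ i =>
    refine LinearMap.ext fun P => ?_
    obtain ⟨p₀, p₁, rfl⟩ := exists_map_inl_add_tensorC_eq i P
    have tensorC_eq : F'.f (i + 1) j h (tensorC p₁) = F.f (i + 1) j h (tensorC p₁) :=
      Subtype.ext ((hF'.apply_tensorC i j (by omega) p₁).trans
        (hF.apply_tensorC i j (by omega) p₁).symm)
    rw [map_add, map_add, hF.restrict, hF'.restrict, tensorC_eq]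

end ExtendCoMomentum

/-! ### Conserved forms -/

section Conservation

variable {E : Type*} [NormedAddCommGroup E] [NormedSpace ℝ E]
  {M : Type*} [TopologicalSpace M] [ChartedSpace E M] [IsManifold 𝓘(ℝ, E) ∞ M]

theorem globallyConserved_of_gradedIota_gradedExtD {X : VField E M} {β : GradedForm E M}
    (h : gradedIota E M X (gradedExtD β) = 0) (j : ℕ) :
    GloballyConserved X (β j : RawForm E M j) := by
  rw [GloballyConserved, ← coe_gradedLieD, gradedLieD_apply, h, add_zero]
  cases j with
  | zero => rfl
  | succ j => exact ⟨_, (gradedIota E M X β j).2, rfl⟩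

variable {𝔤 : Type*} [LieRing 𝔤] [LieAlgebra ℝ 𝔤]
  {m : ℕ} {Ω : Form E M (m + 2)} {v : 𝔤 →ₗ[ℝ] VField E M} {H : Form E M m} {vH : VField E M}

theorem gradedIota_gradedExtD_contraction_hamiltonian
    (hv : ∀ (x y : 𝔤) (a : M), v ⁅x, y⁆ a = VectorField.mlieBracket 𝓘(ℝ, E) (v x) (v y) a)
    (hH : IsHamiltonianVF Ω H vH) (hpres : StrictlyPreserves v H) {q : ExteriorAlgebra ℝ 𝔤}
    (hq : boundaryExt q = 0) :
    gradedIota E M vH (gradedExtD (contraction v q (ofForm E M m H))) = 0 := by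
  have iota_dH : gradedIota E M vH (gradedExtD (ofForm E M m H)) = 0 := by
    rw [← neg_neg (gradedExtD _), ← gradedIota_hamiltonian hH, map_neg, gradedIota_self_self,
      neg_zero]
  rw [gradedExtD_contraction hv (fun x => gradedLieD_ofForm_eq_zero (hpres x)), hq, map_zero,
    map_zero, LinearMap.zero_apply, sub_zero, gradedIota_contraction, iota_dH, map_zero]

theorem globallyConserved_extendF_tensorC (f : CoMomentum Ω v)
    (hv : ∀ (x y : 𝔤) (a : M), v ⁅x, y⁆ a = VectorField.mlieBracket 𝓘(ℝ, E) (v x) (v y) a)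
    (hH : IsHamiltonianVF Ω H vH) (hpres : StrictlyPreserves v H) {i j : ℕ}
    (h : i + 1 + j = m + 1) {p : ⋀[ℝ]^i 𝔤} (hp : p ∈ cycles 𝔤 i) :
    GloballyConserved vH (extendF f H (i + 1) j h (tensorC p) : RawForm E M j) := by
  rw [extendF_tensorC]
  refine globallyConserved_of_gradedIota_gradedExtD
    (β := sgn (i + 1) • contraction v (p : ExteriorAlgebra ℝ 𝔤) (ofForm E M m H)) ?_ j
  rw [map_smul, map_smul, gradedIota_gradedExtD_contraction_hamiltonian hv hH hpres
    (boundaryExt_eq_zero_of_mem_cycles hp), smul_zero]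

end Conservation

end Multisymplectic

end

open Multisymplectic in
theorem mainTheorem9_general
    {E : Type*} [NormedAddCommGroup E] [NormedSpace ℝ E]
    {M : Type*} [TopologicalSpace M] [ChartedSpace E M] [IsManifold 𝓘(ℝ, E) ∞ M]
    {𝔤 : Type*} [LieRing 𝔤] [LieAlgebra ℝ 𝔤]
    (m : ℕ) (Ω : Form E M (m + 2)) (hΩ : IsPlectic Ω)
    (v : 𝔤 →ₗ[ℝ] VField E M)
    (hv : IsMultisymplecticAction Ω v)
    (f : CoMomentum Ω v)
    (H : Form E M m) (vH : VField E M)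
    (hH : IsHamiltonianVF Ω H vH)
    (hpres : StrictlyPreserves v H) :
    IsMultisymplecticAction (𝔤 := 𝔤 × ℝ) Ω (extendAction v vH) ∧
    ∃ F : CoMomentum (𝔤 := 𝔤 × ℝ) Ω (extendAction v vH),
      IsExtension f H F ∧
      (∀ F' : CoMomentum (𝔤 := 𝔤 × ℝ) Ω (extendAction v vH),
        IsExtension f H F' → F' = F) ∧
      ∀ (i j : ℕ) (h : i + j = m), ∀ p ∈ cycles 𝔤 i,
        GloballyConserved vH
          (F.f (i + 1) j (by omega) (tensorC p) :
            RawForm E M j) :=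
  ⟨isMultisymplecticAction_extendAction hΩ hv hH hpres,
    extendCoMomentum f hv.map_lie hH hpres,
    isExtension_extendCoMomentum f hv.map_lie hH hpres,
    fun _ hF' =>
      (isExtension_extendCoMomentum f hv.map_lie hH hpres).unique hF',
    fun _ _ _ _ hp =>
      globallyConserved_extendF_tensorC f hv.map_lie hH hpres (by omega) hp⟩

/-- Here `n = m + 1 ≥ 1`, so `Ω` has degree `n + 1 = m + 2` and `H` has degree `n - 1 = m`;
in the last clause `k = i + 1`. -/
theorem mainTheorem9
    {E : Type*} [NormedAddCommGroup E] [NormedSpace ℝ E] [FiniteDimensional ℝ E]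
    {M : Type*} [TopologicalSpace M] [T2Space M] [SecondCountableTopology M]
    [ChartedSpace E M] [IsManifold 𝓘(ℝ, E) ∞ M]
    {𝔤 : Type*} [LieRing 𝔤] [LieAlgebra ℝ 𝔤]
    (m : ℕ) (Ω : Multisymplectic.Form E M (m + 2)) (hΩ : Multisymplectic.IsPlectic Ω)
    (v : 𝔤 →ₗ[ℝ] Multisymplectic.VField E M)
    (hv : Multisymplectic.IsMultisymplecticAction Ω v)
    (f : Multisymplectic.CoMomentum Ω v)
    (H : Multisymplectic.Form E M m) (vH : Multisymplectic.VField E M)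
    (hH : Multisymplectic.IsHamiltonianVF Ω H vH)
    (hpres : Multisymplectic.StrictlyPreserves v H) :
    Multisymplectic.IsMultisymplecticAction (𝔤 := 𝔤 × ℝ) Ω (Multisymplectic.extendAction v vH) ∧
    ∃ F : Multisymplectic.CoMomentum (𝔤 := 𝔤 × ℝ) Ω (Multisymplectic.extendAction v vH),
      Multisymplectic.IsExtension f H F ∧
      (∀ F' : Multisymplectic.CoMomentum (𝔤 := 𝔤 × ℝ) Ω (Multisymplectic.extendAction v vH),
        Multisymplectic.IsExtension f H F' → F' = F) ∧
      ∀ (i j : ℕ) (h : i + j = m), ∀ p ∈ Multisymplectic.cycles 𝔤 i,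
        Multisymplectic.GloballyConserved vH
          (F.f (i + 1) j (by omega) (Multisymplectic.tensorC p) :
            Multisymplectic.RawForm E M j) :=
  mainTheorem9_general m Ω hΩ v hv f H vH hH hpres
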